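/- **Theorem 1.1.** Let $G=SL(n,\mathbb C)$, let $V,W$ be finite-dimensional rational representations of $G$, and let $v\in V$, $w\in W$ be nonzero vectors. The pair $(v,w)$ is *semistable* if the closures of the orbits $G.[(v,w)]$ and $G.[(v,0)]$ in $\mathbb P(V\oplus W)$ are disjoint. For a maximal algebraic torus $T\subset G$, the weight polytope $\mathcal N_T(v)\subset \mathrm{Lie}(T)^*$ is the convex hull of the weights $\chi$ of $T$ for which the $\chi$-component of $v$ is nonzero. The pair $(v,w)$ is *numerically semistable* if $\mathcal N_T(v)\subset\mathcal N_T(w)$ for all maximal tori $T$. Two irreducible rational representations of $SL(3,\mathbb C)$ with highest weights $aL_1-bL_3$ and $a'L_1-b'L_3$ (where $L_i$ is the $i$-th diagonal entry, viewed as a weight of the diagonal torus) are *homogeneous* if $a+2b=a'+2b'$. 1. Let $G=SL(2,\mathbb C)$ and let $W$ be irreducible ($V$ is arbitrary). Then every numerically semistable pair $(v,w)$ of nonzero vectors $v\in V$, $w\in W$ is semistable. 2. For $G=SL(2,\mathbb C)$ there are examples with $W$ reducible of pairs that are numerically semistable but not semistable. Explicitly, for every integer $n\ge 3$ the following pair is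 one: $V=\operatorname{Sym}^n\mathbb C^2$, $W=\operatorname{Sym}^n\mathbb C^2\oplus\operatorname{Sym}^{n-2}\mathbb C^2$, $v=e_1e_2^{n-1}$, $w=e_1^n+\tilde e_2^{\,n-2}$, where $e_1,e_2$ is the standard basis of $\mathbb C^2$ and $\tilde e_1,\tilde e_2$ is the same basis for the copy of $\mathbb C^2$ in the second summand of $W$. 3. For $G=SL(3,\mathbb C)$ there are irreducible rational representations $V,W$ that are homogeneous, and nonzero vectors $v\in V$, $w\in W$, such that $(v,w)$ is numerically semistable but not semistable. -/

import Mathlib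

open scoped MatrixGroups Topology LinearAlgebra.Projectivization

namespace PairStability

noncomputable section

/-! ### Rational representations -/

/-- `ρ` is a finite-dimensional rational representation of `SL(n, ℂ)`: the space is
finite-dimensional and every matrix coefficient `g ↦ φ (g • v)` is a regular function on
`SL(n, ℂ)`, i.e. (as `SL(n, ℂ)` is closed in the space of matrices) the restriction of a
polynomial in the matrix entries. -/
def IsRational {n : ℕ} {V : Type*} [AddCommGroup V] [Module ℂ V]
    (ρ : Representation ℂ SL(n, ℂ) V) : Prop :=
  FiniteDimensional ℂ V ∧
    ∀ (φ : Module.Dual ℂ V) (v : V), ∃ p : MvPolynomial (Fin n × Fin n) ℂ,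
      ∀ g : SL(n, ℂ), φ (ρ g v) = MvPolynomial.eval (fun ij => g ij.1 ij.2) p

/-! ### Projective orbit closures and semistability -/

/-- The classical topology on the projective space of a finite-dimensional complex vector space
`E`: the quotient topology from `E ∖ {0}`, where `E` carries its canonical vector space
topology. -/
@[reducible] def projTopology (E : Type*) [AddCommGroup E] [Module ℂ E] : TopologicalSpace (ℙ ℂ E) :=
  TopologicalSpace.coinduced
    (fun x : {x : E // x ≠ 0} => Projectivization.mk ℂ x.1 x.2)
    (TopologicalSpace.induced Subtype.val (moduleTopology ℂ E))

/-- The orbit `G.[x]` in the projective space of `E`, for `x ≠ 0` in the representation `E`. -/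
def projOrbit {n : ℕ} {E : Type*} [AddCommGroup E] [Module ℂ E]
    (τ : Representation ℂ SL(n, ℂ) E) (x : E) : Set (ℙ ℂ E) :=
  {p | ∃ (g : SL(n, ℂ)) (h : τ g x ≠ 0), p = Projectivization.mk ℂ (τ g x) h}

/-- The pair `(v, w)` is semistable: the closures in `ℙ(V ⊕ W)` of the orbits of `[(v, w)]` and of
`[(v, 0)]` are disjoint. -/
def Semistable {n : ℕ} {V W : Type*} [AddCommGroup V] [Module ℂ V] [AddCommGroup W] [Module ℂ W]
    (ρ : Representation ℂ SL(n, ℂ) V) (σ : Representation ℂ SL(n, ℂ) W) (v : V) (w : W) : Prop :=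
  closure[projTopology (V × W)] (projOrbit (ρ.prod σ) (v, w)) ∩
    closure[projTopology (V × W)] (projOrbit (ρ.prod σ) (v, 0)) = ∅

/-! ### Tori, weight polytopes and numerical semistability -/

/-- The character `t ↦ t ^ m = ∏ i, t i ^ m i` of `(ℂˣ)^r`. -/
def torusChar {r : ℕ} (m : Fin r → ℤ) (t : Fin r → ℂˣ) : ℂ :=
  ((∏ i, t i ^ m i : ℂˣ) : ℂ)

/-- `φ : (ℂˣ)^r → SL(n, ℂ)` is an injective homomorphism of algebraic groups: its matrix entries
are Laurent polynomials. -/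
def IsTorusEmbedding {n r : ℕ} (φ : (Fin r → ℂˣ) →* SL(n, ℂ)) : Prop :=
  Function.Injective φ ∧
    ∃ A : (Fin r → ℤ) →₀ Matrix (Fin n) (Fin n) ℂ,
      ∀ t, (φ t : Matrix (Fin n) (Fin n) ℂ) = A.sum fun m a => torusChar m t • a

/-- `T` is an algebraic torus in `SL(n, ℂ)`: it is the image of an embedding of some
`(ℂˣ)^r`. -/
def IsTorus {n : ℕ} (T : Subgroup SL(n, ℂ)) : Prop :=
  ∃ (r : ℕ) (φ : (Fin r → ℂˣ) →* SL(n, ℂ)), IsTorusEmbedding φ ∧ φ.range = T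

/-- The set of weights of `v` under the torus parametrized by `φ`: the `m ∈ ℤ^r` such that the
component of `v` in the weight space `{u | ∀ t, φ(t) • u = t ^ m u}` is nonzero. -/
def weightSupport {n r : ℕ} {V : Type*} [AddCommGroup V] [Module ℂ V]
    (φ : (Fin r → ℂˣ) →* SL(n, ℂ)) (ρ : Representation ℂ SL(n, ℂ) V) (v : V) :
    Set (Fin r → ℤ) :=
  {m | ∃ c : (Fin r → ℤ) →₀ V,
    (∀ m' t, ρ (φ t) (c m') = torusChar m' t • c m') ∧ (c.sum fun _ u => u) = v ∧ c m ≠ 0}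

/-- The weight polytope of `v` for the torus `T` parametrized by `φ : (ℂˣ)^r ≃ T`: the convex hull
of the weights of `v`, in `ℝ^r ≃ Lie(T)^*` (the real span of the character lattice `ℤ^r` of
`T`). -/
def weightPolytope {n r : ℕ} {V : Type*} [AddCommGroup V] [Module ℂ V]
    (φ : (Fin r → ℂˣ) →* SL(n, ℂ)) (ρ : Representation ℂ SL(n, ℂ) V) (v : V) :
    Set (Fin r → ℝ) :=
  convexHull ℝ ((fun (m : Fin r → ℤ) (i : Fin r) => (m i : ℝ)) '' weightSupport φ ρ v)

/-- The pair `(v, w)` is numerically semistable: the weight polytope of `v` is contained in that of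
`w`, for all maximal tori. -/
def NumericallySemistable {n : ℕ} {V W : Type*} [AddCommGroup V] [Module ℂ V]
    [AddCommGroup W] [Module ℂ W]
    (ρ : Representation ℂ SL(n, ℂ) V) (σ : Representation ℂ SL(n, ℂ) W) (v : V) (w : W) : Prop :=
  ∀ (r : ℕ) (φ : (Fin r → ℂˣ) →* SL(n, ℂ)), IsTorusEmbedding φ → Maximal IsTorus φ.range →
    weightPolytope φ ρ v ⊆ weightPolytope φ σ w

/-! ### Highest weights and homogeneous pairs of irreducible representations -/

/-- `ρ` has highest weight `∑ i, l i • L i`, where `l` is a partition whose last part is `0` and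
`L i` is the `i`-th diagonal entry: there is a nonzero vector on which every upper triangular
matrix `g` acts by the scalar `∏ i, g i i ^ l i`. For an irreducible rational representation such a
partition exists and is unique. -/
def HasHighestWeight {n : ℕ} {V : Type*} [AddCommGroup V] [Module ℂ V]
    (ρ : Representation ℂ SL(n, ℂ) V) (l : Fin n → ℕ) : Prop :=
  Antitone l ∧ (∃ i, l i = 0) ∧
    ∃ u : V, u ≠ 0 ∧ ∀ g : SL(n, ℂ), (∀ i j, j < i → g i j = 0) →
      ρ g u = (∏ i, g i i ^ l i) • u

/-- Two irreducible representations are homogeneous if the partitions of their highest weights have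
the same size. (For `SL(3, ℂ)`, the irreducible representation with highest weight
`a L_1 - b L_3` has the partition `(a + b, b, 0)`, of size `a + 2 b`.) -/
def Homogeneous {n : ℕ} {V W : Type*} [AddCommGroup V] [Module ℂ V] [AddCommGroup W] [Module ℂ W]
    (ρ : Representation ℂ SL(n, ℂ) V) (σ : Representation ℂ SL(n, ℂ) W) : Prop :=
  ∃ l l' : Fin n → ℕ, HasHighestWeight ρ l ∧ HasHighestWeight σ l' ∧ ∑ i, l i = ∑ i, l' i

/-! ### Symmetric powers of the standard representation -/

/-- The linear substitution `e_j ↦ g e_j = ∑ i, g i j • e_i`, where the variable `X i` stands for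
the basis vector `e_i`. -/
def substHom {n : ℕ} (g : SL(n, ℂ)) : MvPolynomial (Fin n) ℂ →ₐ[ℂ] MvPolynomial (Fin n) ℂ :=
  MvPolynomial.aeval fun j => ∑ i, g i j • MvPolynomial.X i

theorem substHom_one {n : ℕ} : substHom (1 : SL(n, ℂ)) = AlgHom.id ℂ _ := by
  ext1 j
  simp [substHom, Matrix.one_apply]

theorem substHom_mul {n : ℕ} (g h : SL(n, ℂ)) :
    substHom (g * h) = (substHom g).comp (substHom h) := by
  ext1 j
  simp only [substHom, MvPolynomial.aeval_X, AlgHom.comp_apply, map_sum, map_smul,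
    Matrix.SpecialLinearGroup.coe_mul, Matrix.mul_apply, Finset.smul_sum, Finset.sum_smul,
    smul_smul]
  rw [Finset.sum_comm]
  simp only [mul_comm]

theorem substHom_mem {n : ℕ} (d : ℕ) (g : SL(n, ℂ)) (p : MvPolynomial (Fin n) ℂ)
    (hp : p ∈ MvPolynomial.homogeneousSubmodule (Fin n) ℂ d) :
    substHom g p ∈ MvPolynomial.homogeneousSubmodule (Fin n) ℂ d := by
  rw [MvPolynomial.mem_homogeneousSubmodule] at hp ⊢
  have h := hp.aeval (n := 1) (fun j => ∑ i, g i j • (MvPolynomial.X i : MvPolynomial (Fin n) ℂ))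
    (fun j => MvPolynomial.IsHomogeneous.sum _ _ _ fun i _ =>
      (MvPolynomial.homogeneousSubmodule (Fin n) ℂ 1).smul_mem _ (MvPolynomial.isHomogeneous_X ℂ i))
  rwa [one_mul] at h

/-- `Sym^d ℂ^n`, as the space of homogeneous polynomials of degree `d` in the standard basis
vectors `e_i = X i`. -/
abbrev Sym (n d : ℕ) : Type := MvPolynomial.homogeneousSubmodule (Fin n) ℂ d

/-- The representation of `SL(n, ℂ)` on `Sym^d ℂ^n`. -/
def symRep (n d : ℕ) : Representation ℂ SL(n, ℂ) (Sym n d) where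
  toFun g := (substHom g).toLinearMap.restrict (substHom_mem d g)
  map_one' := by
    ext p : 2
    simp [substHom_one, LinearMap.restrict_apply]
  map_mul' g h := by
    ext p : 2
    simp only [substHom_mul, AlgHom.comp_toLinearMap]
    rfl

/-- The monomial `e_1 ^ a * e_2 ^ b` in `Sym^d ℂ²`, where `a + b = d`. -/
def monomial₂ {d : ℕ} (a b : ℕ) (h : a + b = d) : Sym 2 d :=
  ⟨MvPolynomial.X 0 ^ a * MvPolynomial.X 1 ^ b, h ▸
    ((MvPolynomial.isHomogeneous_X_pow 0 a).mul (MvPolynomial.isHomogeneous_X_pow 1 b))⟩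

end

end PairStability

namespace PairStability

noncomputable section


/-! ### Characters of tori and Laurent polynomial functions -/

/-! Fix norms on `V` and `W`. An inequality `‖g v‖ ≤ C ‖g w‖` for all `g` forces semistability
(`semistable_of_le`): the closed condition `‖x‖ ≤ C ‖y‖` holds on the first orbit closure and `y =
0` on the second. Conversely, scalars and group elements that send `v` to a nonzero limit and `w` to
`0` refute semistability (`not_semistable_of_tendsto`).

Positive result for SL(2). Numerical semistability for the conjugates of the diagonal torus says
that no weight of `g v` exceeds the highest weight of `g w` (`WeightDominated`). Complete pivoting
writes `g = k · diag(p, p⁻¹) · u(x) · h` with `k` bounded, `|p| ≥ 1/2`, `|x| ≤ 1` and two choices of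
`h`. By compactness of the disc and translation, the norm inequality is needed only for `x` near
`0`. Let `μ` be the highest weight occurring in `w`, and `μ + 2n` that of `W`. The coordinates of
`diag(p, p⁻¹) u(x) w` of these two weights have sizes comparable to `|p|^μ` and `|p|^(μ+2n) |x|^n`.
The second estimate is where irreducibility enters: the top coordinate of `u(x) w` vanishes at `0`
to order exactly `n` (`exists_order_upperSL2`). The coordinates of `v` give terms `|p|^m |x|^k` with
`m ≤ μ + 2k` and `m ≤ μ + 2n`, which interpolate between these two sizes (`zpow_mul_pow_le`).

Counterexamples. Numerical semistability is checked on support functions, for every `g` and every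
real functional `l` (`numericallySemistable_of_support`). For SL(2), if the leading coordinate of `g
e₁` is nonzero then `(g e₁)^n` dominates; otherwise `g v` is divisible by the other basis vector,
and that loss lets `(g e₂)^(n-2)` suffice. A unipotent degeneration makes `g v` grow faster than `g
w`.

For SL(3), `v = e₁* e₃*` in `Sym² (ℂ³)*`, and `w` in `Sym⁴ ℂ³` is the product of the conics `e₁e₃ -
e₂² ± e₃²`. As quadratic forms on row vectors they are nondegenerate and have only the line of `e₁*`
as common zeros. Nondegeneracy bounds their support functions from below; in the one case where the
bound falls short, the special row is a multiple of `e₁*` and the same divisibility argument lowers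
the weights of `g v`. Elements of the stabilizer of `e₁e₃ - e₂²` keep `w` bounded while `v`
diverges. Irreducibility of the symmetric powers is proved by evaluating matrix coefficients on rank
one matrices. -/

/-- The character `t ↦ t ^ m` as a monoid homomorphism. -/
def torusCharHom {r : ℕ} (m : Fin r → ℤ) : (Fin r → ℂˣ) →* ℂ where
  toFun := torusChar m
  map_one' := by simp [torusChar]
  map_mul' s t := by simp [torusChar, mul_zpow, Finset.prod_mul_distrib]

theorem torusChar_one {r : ℕ} (m : Fin r → ℤ) : torusChar m 1 = 1 := (torusCharHom m).map_one

theorem torusChar_mul {r : ℕ} (m : Fin r → ℤ) (s t : Fin r → ℂˣ) :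
    torusChar m (s * t) = torusChar m s * torusChar m t := (torusCharHom m).map_mul s t

theorem torusChar_zero {r : ℕ} (t : Fin r → ℂˣ) : torusChar 0 t = 1 := by simp [torusChar]

theorem torusChar_add {r : ℕ} (m m' : Fin r → ℤ) (t : Fin r → ℂˣ) :
    torusChar (m + m') t = torusChar m t * torusChar m' t := by
  simp [torusChar, zpow_add, Finset.prod_mul_distrib]

theorem two_zpow_injective {a b : ℤ} (h : (2 : ℂ) ^ a = 2 ^ b) : a = b := by
  have h' : (2 : ℝ) ^ a = 2 ^ b := by simpa using congrArg norm h
  exact zpow_right_injective₀ (by norm_num) (by norm_num) h'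

theorem torusCharHom_injective {r : ℕ} :
    Function.Injective (torusCharHom : (Fin r → ℤ) → (Fin r → ℂˣ) →* ℂ) := by
  intro m m' h
  funext i
  have h2 := DFunLike.congr_fun h (Pi.mulSingle i (Units.mk0 2 two_ne_zero))
  have key : ∀ m : Fin r → ℤ,
      torusCharHom m (Pi.mulSingle i (Units.mk0 2 two_ne_zero)) = (2 : ℂ) ^ m i := by
    intro m
    change torusChar m _ = _
    rw [torusChar, Finset.prod_eq_single i]
    · simp
    · intro j _ hj
      simp [Pi.mulSingle_eq_of_ne hj]
    · simp
  rw [key, key] at h2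
  exact two_zpow_injective h2

theorem torusChar_injective {r : ℕ} {m m' : Fin r → ℤ} (h : ∀ t, torusChar m t = torusChar m' t) :
    m = m' := torusCharHom_injective (MonoidHom.ext h)

theorem linearIndependent_torusChar {r : ℕ} :
    LinearIndependent ℂ (fun m : Fin r → ℤ => (torusChar m : (Fin r → ℂˣ) → ℂ)) :=
  (linearIndependent_monoidHom (Fin r → ℂˣ) ℂ).comp torusCharHom torusCharHom_injective

/-- A vector-valued Laurent polynomial that vanishes identically has zero coefficients. -/
theorem eq_zero_of_sum_torusChar_smul {r : ℕ} {V : Type*} [AddCommGroup V] [Module ℂ V]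
    (c : (Fin r → ℤ) →₀ V) (h : ∀ t, (c.sum fun m u => torusChar m t • u) = 0) : c = 0 := by
  ext m
  by_contra hm
  obtain ⟨φ, hφ⟩ : ∃ φ : Module.Dual ℂ V, φ (c m) ≠ 0 := by
    by_contra! hφ
    exact hm ((Module.forall_dual_apply_eq_zero_iff ℂ _).1 hφ)
  -- Dedekind independence of characters, applied after a functional that detects the supposed
  -- nonzero coefficient.
  have h0 : c.mapRange φ φ.map_zero = 0 := by
    refine linearIndependent_iff.1 linearIndependent_torusChar _ ?_
    funext t
    have := congrArg φ (h t)
    rw [Finsupp.linearCombination_apply, Finsupp.sum_mapRange_index (by simp)]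
    simpa [Finsupp.sum, mul_comm] using this
  exact hφ (by simpa using DFunLike.congr_fun h0 m)

/-- The algebra of Laurent polynomial functions on `(ℂˣ)^r`. -/
def laurent (r : ℕ) : Subalgebra ℂ ((Fin r → ℂˣ) → ℂ) :=
  Submodule.toSubalgebra (Submodule.span ℂ (Set.range fun m : Fin r → ℤ => torusChar m))
    (Submodule.subset_span ⟨0, by funext t; simp [torusChar_zero]⟩) (by
      intro f g hf hg
      induction hf using Submodule.span_induction with
      | mem f hf =>
        obtain ⟨m, rfl⟩ := hf
        induction hg using Submodule.span_induction with
        | mem g hg =>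
          obtain ⟨m', rfl⟩ := hg
          exact Submodule.subset_span ⟨m + m', by funext t; simp [torusChar_add]⟩
        | zero => simp
        | add x y _ _ hx hy => rw [mul_add]; exact add_mem hx hy
        | smul a x _ hx => rw [mul_smul_comm]; exact Submodule.smul_mem _ _ hx
      | zero => simp
      | add x y _ _ hx hy => rw [add_mul]; exact add_mem hx hy
      | smul a x _ hx => rw [smul_mul_assoc]; exact Submodule.smul_mem _ _ hx)

theorem mem_laurent_iff {r : ℕ} {f : (Fin r → ℂˣ) → ℂ} :
    f ∈ laurent r ↔ ∃ c : (Fin r → ℤ) →₀ ℂ, ∀ t, f t = c.sum fun m a => a * torusChar m t := by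
  rw [laurent, Submodule.mem_toSubalgebra, Finsupp.mem_span_range_iff_exists_finsupp]
  refine exists_congr fun c => ?_
  rw [eq_comm, funext_iff]
  refine forall_congr' fun t => ?_
  simp [Finsupp.sum, Finset.sum_apply]

/-- The coefficients of a Laurent polynomial `t ↦ R t v` along a homomorphism `R` decompose `v`
into weight vectors. -/
theorem weight_decomposition_of_laurent {r : ℕ} {V : Type*} [AddCommGroup V] [Module ℂ V]
    (R : (Fin r → ℂˣ) →* (V →ₗ[ℂ] V)) (v : V) (c : (Fin r → ℤ) →₀ V)
    (h : ∀ t, R t v = c.sum fun m u => torusChar m t • u) :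
    (∀ m t, R t (c m) = torusChar m t • c m) ∧ (c.sum fun _ u => u) = v := by
  constructor
  · intro m s
    -- The difference of the coefficients of `t ↦ R s (R t v)` and of `t ↦ R (s * t) v`; the two
    -- functions agree, so it vanishes.
    let d : (Fin r → ℤ) →₀ V := c.mapRange (R s) (map_zero _) -
      c.zipWith (fun _ u => u) rfl (Finsupp.onFinset c.support
        (fun m => torusChar m s • c m) (by intro m; contrapose!; simp +contextual))
    have hd : d = 0 := by
      refine eq_zero_of_sum_torusChar_smul d fun t => ?_
      have h1 : R (s * t) v = R s (R t v) := by rw [map_mul]; rfl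
      rw [h, h] at h1
      rw [Finsupp.sum_of_support_subset (s := c.support) d _ _ (by simp)]
      · simp only [d, Finsupp.coe_sub, Pi.sub_apply, Finsupp.mapRange_apply,
          Finsupp.zipWith_apply, Finsupp.onFinset_apply, smul_sub, Finset.sum_sub_distrib]
        simp only [Finsupp.sum, map_sum, map_smul, torusChar_mul] at h1
        rw [← h1, sub_eq_zero]
        refine Finset.sum_congr rfl fun m _ => ?_
        rw [smul_smul, mul_comm]
      · intro m hm
        contrapose! hm
        simp only [Finsupp.mem_support_iff, not_not] at hm ⊢
        simp [d, hm]
    have := DFunLike.congr_fun hd m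
    simpa [d, sub_eq_zero] using this
  · have := h 1
    simp only [map_one, torusChar_one, one_smul] at this
    exact this.symm

theorem exists_finsupp_of_laurent {r : ℕ} {V : Type*} [AddCommGroup V] [Module ℂ V]
    [FiniteDimensional ℂ V] (f : (Fin r → ℂˣ) → V)
    (h : ∀ φ : Module.Dual ℂ V, (fun t => φ (f t)) ∈ laurent r) :
    ∃ c : (Fin r → ℤ) →₀ V, ∀ t, f t = c.sum fun m u => torusChar m t • u := by
  let b := Module.finBasis ℂ V
  choose c hc using fun i => mem_laurent_iff.1 (h (b.coord i))
  refine ⟨∑ i, (c i).mapRange (fun a => a • b i) (zero_smul _ _), fun t => ?_⟩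
  rw [← Finsupp.sum_finsetSum_index (by simp) (by intros; simp), ← b.sum_repr (f t)]
  refine Finset.sum_congr rfl fun i _ => ?_
  rw [Finsupp.sum_mapRange_index (by simp)]
  have := hc i t
  simp only [Module.Basis.coord_apply] at this
  rw [this, Finsupp.sum, Finset.sum_smul]
  exact Finset.sum_congr rfl fun m _ => by simp only [smul_smul, mul_comm]

theorem IsTorusEmbedding.entry_mem_laurent {n r : ℕ} {φ : (Fin r → ℂˣ) →* SL(n, ℂ)}
    (hφ : IsTorusEmbedding φ) (i j : Fin n) : (fun t => φ t i j) ∈ laurent r := by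
  obtain ⟨-, A, hA⟩ := hφ
  refine mem_laurent_iff.2 ⟨A.mapRange (fun a => a i j) rfl, fun t => ?_⟩
  refine Eq.trans ?_ (Finsupp.sum_mapRange_index (by simp)).symm
  have := congrFun (congrFun (hA t) i) j
  simpa [Finsupp.sum, Matrix.sum_apply, mul_comm] using this

theorem eval_mem_laurent {σ : Type*} {r : ℕ} (x : σ → (Fin r → ℂˣ) → ℂ)
    (hx : ∀ i, x i ∈ laurent r) (p : MvPolynomial σ ℂ) :
    (fun t => MvPolynomial.eval (fun i => x i t) p) ∈ laurent r := by
  induction p using MvPolynomial.induction_on with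
  | C a =>
    simp only [MvPolynomial.eval_C]
    exact (laurent r).algebraMap_mem a
  | add p q hp hq => simp only [map_add]; exact add_mem hp hq
  | mul_X p i hp => simp only [map_mul, MvPolynomial.eval_X]; exact mul_mem hp (hx i)

/-- A vector in a rational representation is a sum of weight vectors of a torus. -/
theorem IsRational.exists_weight_decomposition {n r : ℕ} {V : Type*} [AddCommGroup V] [Module ℂ V]
    {ρ : Representation ℂ SL(n, ℂ) V} (hρ : IsRational ρ) {φ : (Fin r → ℂˣ) →* SL(n, ℂ)}
    (hφ : IsTorusEmbedding φ) (v : V) :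
    ∃ c : (Fin r → ℤ) →₀ V, (∀ m t, ρ (φ t) (c m) = torusChar m t • c m) ∧
      (c.sum fun _ u => u) = v := by
  obtain ⟨hV, hρ⟩ := hρ
  obtain ⟨c, hc⟩ := exists_finsupp_of_laurent (fun t => ρ (φ t) v) (by
    intro ψ
    obtain ⟨p, hp⟩ := hρ ψ v
    have h := eval_mem_laurent (fun (ij : Fin n × Fin n) t => φ t ij.1 ij.2)
      (fun ij => hφ.entry_mem_laurent ij.1 ij.2) p
    have e : (fun t => ψ (ρ (φ t) v)) =
        fun t => MvPolynomial.eval (fun ij : Fin n × Fin n => φ t ij.1 ij.2) p :=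
      funext fun t => hp (φ t)
    rw [e]
    exact h)
  have hw := weight_decomposition_of_laurent (MonoidHom.comp ρ φ) v c hc
  exact ⟨c, hw⟩

/-- The support of a vector can be read off from enough linear forms that are weight vectors. -/
theorem weightSupport_eq {n r : ℕ} {V : Type*} [AddCommGroup V] [Module ℂ V]
    {ρ : Representation ℂ SL(n, ℂ) V} (hρ : IsRational ρ) {φ : (Fin r → ℂˣ) →* SL(n, ℂ)}
    (hφ : IsTorusEmbedding φ) {ι : Type*} (coord : ι → Module.Dual ℂ V) (wt : ι → Fin r → ℤ)
    (hsep : ∀ x, (∀ i, coord i x = 0) → x = 0)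
    (hwt : ∀ i t x, coord i (ρ (φ t) x) = torusChar (wt i) t * coord i x) (v : V) :
    weightSupport φ ρ v = wt '' {i | coord i v ≠ 0} := by
  -- A form of weight `wt i` kills weight vectors of any other weight, since distinct exponents give
  -- distinct characters.
  have key : ∀ c : (Fin r → ℤ) →₀ V, (∀ m' t, ρ (φ t) (c m') = torusChar m' t • c m') →
      ∀ i m, coord i (c m) ≠ 0 → m = wt i := by
    intro c hc i m him
    refine torusChar_injective fun t => ?_
    have := hwt i t (c m)
    rw [hc, map_smul, smul_eq_mul] at this
    exact mul_right_cancel₀ him this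
  have key2 : ∀ c : (Fin r → ℤ) →₀ V, (∀ m' t, ρ (φ t) (c m') = torusChar m' t • c m') →
      (c.sum fun _ u => u) = v → ∀ i, coord i v = coord i (c (wt i)) := by
    intro c hc hs i
    rw [← hs, Finsupp.sum, map_sum]
    refine Finset.sum_eq_single _ (fun m _ hm => ?_) (by simp +contextual)
    by_contra h
    exact hm (key c hc i m h)
  ext m
  constructor
  · rintro ⟨c, hc, hs, hm⟩
    obtain ⟨i, hi⟩ : ∃ i, coord i (c m) ≠ 0 := by
      by_contra! h
      exact hm (hsep _ h)
    have := key c hc i m hi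
    subst this
    exact ⟨i, by simpa [key2 c hc hs i] using hi, rfl⟩
  · rintro ⟨i, hi, rfl⟩
    obtain ⟨c, hc, hs⟩ := hρ.exists_weight_decomposition hφ v
    refine ⟨c, hc, hs, fun h => hi ?_⟩
    rw [key2 c hc hs i, h, map_zero]


/-! ### Weight bases and diagonalization of tori -/

/-- Weight vectors span by the weight decomposition, so a basis can be selected among them. -/
theorem IsRational.exists_weight_basis {n r : ℕ} {V : Type*} [AddCommGroup V] [Module ℂ V]
    {ρ : Representation ℂ SL(n, ℂ) V} (hρ : IsRational ρ) {φ : (Fin r → ℂˣ) →* SL(n, ℂ)}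
    (hφ : IsTorusEmbedding φ) :
    ∃ (b : Module.Basis (Fin (Module.finrank ℂ V)) ℂ V)
      (wt : Fin (Module.finrank ℂ V) → Fin r → ℤ),
      ∀ i t, ρ (φ t) (b i) = torusChar (wt i) t • b i := by
  have := hρ.1
  let S : Set V := {x | ∃ m, ∀ t, ρ (φ t) x = torusChar m t • x}
  have hS : ⊤ ≤ Submodule.span ℂ S := by
    intro v _
    obtain ⟨c, hc, hs⟩ := hρ.exists_weight_decomposition hφ v
    rw [← hs]
    exact Submodule.sum_mem _ fun m _ => Submodule.subset_span ⟨m, hc m⟩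
  let b := Module.Basis.ofSpan hS
  let e := b.indexEquiv (Module.finBasis ℂ V)
  have hb : ∀ i, ∃ m, ∀ t, ρ (φ t) (b.reindex e i) = torusChar m t • b.reindex e i := fun i =>
    Module.Basis.ofSpan_subset hS ⟨e.symm i, by simp [b]⟩
  choose wt hwt using hb
  exact ⟨b.reindex e, wt, hwt⟩

theorem coord_weight {K V ι : Type*} [Field K] [AddCommGroup V] [Module K V]
    (b : Module.Basis ι K V) (T : V →ₗ[K] V) (a : ι → K) (h : ∀ i, T (b i) = a i • b i) (i : ι)
    (x : V) : b.coord i (T x) = a i * b.coord i x := by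
  classical
  have : b.coord i ∘ₗ T = a i • b.coord i := by
    refine b.ext fun j => ?_
    rcases eq_or_ne j i with rfl | hj
    · simp [h]
    · simp [h, Finsupp.single_eq_of_ne hj.symm]
  exact LinearMap.congr_fun this x

/-- The standard representation of `SL(n, ℂ)` on `ℂ^n`. -/
def stdRep (n : ℕ) : Representation ℂ SL(n, ℂ) (Fin n → ℂ) where
  toFun g := Matrix.mulVecLin (g : Matrix (Fin n) (Fin n) ℂ)
  map_one' := by simp; rfl
  map_mul' g h := by simp [Matrix.mulVecLin_mul]; rfl

theorem stdRep_apply {n : ℕ} (g : SL(n, ℂ)) (v : Fin n → ℂ) :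
    stdRep n g v = (g : Matrix (Fin n) (Fin n) ℂ).mulVec v := rfl

theorem isRational_stdRep (n : ℕ) : IsRational (stdRep n) := by
  refine ⟨inferInstance, fun φ v => ?_⟩
  refine ⟨∑ i, ∑ j, MvPolynomial.C (φ (Pi.single i 1) * v j) * MvPolynomial.X (i, j), fun g => ?_⟩
  rw [stdRep_apply, LinearMap.pi_apply_eq_sum_univ φ]
  simp only [map_sum, map_mul, MvPolynomial.eval_C, MvPolynomial.eval_X, Matrix.mulVec,
    dotProduct, Finset.sum_mul, smul_eq_mul]
  refine Finset.sum_congr rfl fun i _ => Finset.sum_congr rfl fun j _ => ?_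
  have : (fun j => if i = j then (1 : ℂ) else 0) = Pi.single i 1 := by
    funext j; simp [Pi.single_apply, eq_comm]
  rw [this]
  ring

/-- A torus in `SL(n, ℂ)` is conjugate to a group of diagonal matrices. -/
theorem IsTorusEmbedding.exists_diagonal {n r : ℕ} {φ : (Fin r → ℂˣ) →* SL(n, ℂ)}
    (hφ : IsTorusEmbedding φ) : ∃ (g : SL(n, ℂ)) (m : Fin n → Fin r → ℤ),
      ∀ t, ((g * φ t * g⁻¹ : SL(n, ℂ)) : Matrix (Fin n) (Fin n) ℂ) =
        Matrix.diagonal fun i => torusChar (m i) t := by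
  -- A weight basis of the standard representation diagonalizes the torus simultaneously.
  obtain ⟨b', wt', hwt'⟩ := (isRational_stdRep n).exists_weight_basis hφ
  obtain ⟨b, wt, hwt⟩ : ∃ (b : Module.Basis (Fin n) ℂ (Fin n → ℂ)) (wt : Fin n → Fin r → ℤ),
      ∀ i t, (φ t : Matrix (Fin n) (Fin n) ℂ).mulVec (b i) = torusChar (wt i) t • b i := by
    have e : Module.finrank ℂ (Fin n → ℂ) = n := by simp
    exact ⟨b'.reindex (finCongr e), wt' ∘ finCongr e.symm, fun i t => by
      simpa [stdRep_apply] using hwt' (finCongr e.symm i) t⟩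
  let B : Matrix (Fin n) (Fin n) ℂ := Matrix.of fun i j => b j i
  have hB : IsUnit B.det := by
    have : B = (Pi.basisFun ℂ (Fin n)).toMatrix b := by
      ext i j; simp [B, Module.Basis.toMatrix_apply]
    rw [this]
    exact (Pi.basisFun ℂ (Fin n)).isUnit_det b
  have hφB : ∀ t, (φ t : Matrix (Fin n) (Fin n) ℂ) * B =
      B * Matrix.diagonal fun i => torusChar (wt i) t := by
    intro t
    ext i j
    rw [Matrix.mul_diagonal, mul_comm]
    exact congrFun (hwt j t) i
  rcases Nat.eq_zero_or_pos n with rfl | hn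
  · exact ⟨1, wt, fun t => by ext i; exact i.elim0⟩
  have hn' : n ≠ 0 := hn.ne'
  -- An `n`-th root rescales the change of basis to determinant one; this needs `n ≠ 0`.
  obtain ⟨c, hc⟩ := IsAlgClosed.exists_pow_nat_eq B.det⁻¹ hn
  have hc0 : c ≠ 0 := by
    rintro rfl
    rw [zero_pow hn'] at hc
    exact inv_ne_zero hB.ne_zero hc.symm
  let h : SL(n, ℂ) := ⟨c • B, by
    rw [Matrix.det_smul, Fintype.card_fin, hc, inv_mul_cancel₀ hB.ne_zero]⟩
  refine ⟨h⁻¹, wt, fun t => ?_⟩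
  have h1 : ((φ t * h : SL(n, ℂ)) : Matrix (Fin n) (Fin n) ℂ) =
      (h : Matrix (Fin n) (Fin n) ℂ) * Matrix.diagonal fun i => torusChar (wt i) t := by
    rw [Matrix.SpecialLinearGroup.coe_mul]
    change _ * (c • B) = (c • B) * _
    rw [Matrix.mul_smul, hφB, Matrix.smul_mul]
  rw [inv_inv, mul_assoc, Matrix.SpecialLinearGroup.coe_mul, h1, ← mul_assoc,
    ← Matrix.SpecialLinearGroup.coe_mul]
  simp

/-! ### A criterion for numerical semistability -/

theorem torusChar_sum_mul {n r : ℕ} (k : Fin n → ℤ) (m : Fin n → Fin r → ℤ) (t : Fin r → ℂˣ) :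
    ∏ j, torusChar (m j) t ^ k j = torusChar (fun s => ∑ j, k j * m j s) t := by
  simp only [torusChar, Units.coe_prod, Units.val_zpow_eq_zpow_val]
  simp only [← Finset.prod_zpow, ← zpow_mul]
  rw [Finset.prod_comm]
  refine Finset.prod_congr rfl fun s _ => ?_
  have : ∀ f : Fin n → ℤ, ((t s : ℂˣ) : ℂ) ^ ∑ j, f j = ∏ j, ((t s : ℂˣ) : ℂ) ^ f j := by
    intro f
    induction (Finset.univ : Finset (Fin n)) using Finset.induction_on with
    | empty => simp
    | insert a s' ha ih =>
      rw [Finset.sum_insert ha, Finset.prod_insert ha, zpow_add₀ (Units.ne_zero _), ih]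
  rw [this]
  exact Finset.prod_congr rfl fun j _ => by rw [mul_comm]

/-- A family of linear forms on which the diagonal torus acts by the weights `wt`. -/
structure IsWeightCoord {n : ℕ} {V ι : Type*} [AddCommGroup V] [Module ℂ V]
    (ρ : Representation ℂ SL(n, ℂ) V) (coord : ι → Module.Dual ℂ V) (wt : ι → Fin n → ℤ) :
    Prop where
  eq_zero : ∀ x, (∀ i, coord i x = 0) → x = 0
  finite : ∀ x, {i | coord i x ≠ 0}.Finite
  weight : ∀ (d : SL(n, ℂ)) (a : Fin n → ℂ), (d : Matrix (Fin n) (Fin n) ℂ) = Matrix.diagonal a →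
    ∀ i x, coord i (ρ d x) = (∏ j, a j ^ wt i j) * coord i x

/-- Since `g` conjugates the torus into the diagonal one, the forms `coord i ∘ ρ g` are weight forms
for it, with the diagonal weights pulled back along `m`. -/
theorem IsWeightCoord.weightSupport_eq {n r : ℕ} {V ι : Type*} [AddCommGroup V] [Module ℂ V]
    {ρ : Representation ℂ SL(n, ℂ) V} {coord : ι → Module.Dual ℂ V} {wt : ι → Fin n → ℤ}
    (h : IsWeightCoord ρ coord wt) (hρ : IsRational ρ) {φ : (Fin r → ℂˣ) →* SL(n, ℂ)}
    (hφ : IsTorusEmbedding φ) {g : SL(n, ℂ)} {m : Fin n → Fin r → ℤ}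
    (hg : ∀ t, ((g * φ t * g⁻¹ : SL(n, ℂ)) : Matrix (Fin n) (Fin n) ℂ) =
        Matrix.diagonal fun i => torusChar (m i) t) (v : V) :
    weightSupport φ ρ v =
      (fun i s => ∑ j, wt i j * m j s) '' {i | coord i (ρ g v) ≠ 0} := by
  refine PairStability.weightSupport_eq hρ hφ (fun i => coord i ∘ₗ ρ g) _ (fun x hx => ?_)
    (fun i t x => ?_) v
  · have h0 := h.eq_zero _ hx
    have := congrArg (ρ g⁻¹) h0
    rwa [map_zero, ← Module.End.mul_apply, ← map_mul, inv_mul_cancel, map_one] at this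
  · have h1 := h.weight _ _ (hg t) i (ρ g x)
    rw [torusChar_sum_mul, ← Module.End.mul_apply, ← map_mul] at h1
    simpa [mul_assoc] using h1

/-- A point outside a compact polytope is separated from it by a functional. Pulled back to the
diagonal weights, the functional is some `l`, so comparing support functions for all `g` and `l`
covers every torus at once. -/
theorem numericallySemistable_of_support {n : ℕ} {V W ι κ : Type*} [AddCommGroup V] [Module ℂ V]
    [AddCommGroup W] [Module ℂ W]
    {ρ : Representation ℂ SL(n, ℂ) V} {σ : Representation ℂ SL(n, ℂ) W}
    (hρ : IsRational ρ) (hσ : IsRational σ)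
    {cV : ι → Module.Dual ℂ V} {wV : ι → Fin n → ℤ} (hV : IsWeightCoord ρ cV wV)
    {cW : κ → Module.Dual ℂ W} {wW : κ → Fin n → ℤ} (hW : IsWeightCoord σ cW wW) {v : V} {w : W}
    (H : ∀ (g : SL(n, ℂ)) (l : Fin n → ℝ) (i : ι), cV i (ρ g v) ≠ 0 →
      ∃ j, cW j (σ g w) ≠ 0 ∧ ∑ k, l k * wV i k ≤ ∑ k, l k * wW j k) :
    NumericallySemistable ρ σ v w := by
  intro r φ hφ _
  obtain ⟨g, m, hg⟩ := hφ.exists_diagonal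
  rw [weightPolytope, weightPolytope, hV.weightSupport_eq hρ hφ hg, hW.weightSupport_eq hσ hφ hg]
  refine convexHull_min ?_ (convex_convexHull ℝ _)
  rintro _ ⟨_, ⟨i, hi, rfl⟩, rfl⟩
  by_contra hx
  have hfin : ((fun (m : Fin r → ℤ) (i : Fin r) => (m i : ℝ)) ''
      ((fun i s => ∑ j, wW i j * m j s) '' {i | cW i (σ g w) ≠ 0})).Finite :=
    ((hW.finite _).image _).image _
  obtain ⟨f, u, hs, hu⟩ :=
    geometric_hahn_banach_closed_point (convex_convexHull ℝ _) (hfin.isClosed_convexHull ℝ) hx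
  obtain ⟨j, hj, hle⟩ := H g (fun k => f fun s => (m k s : ℝ)) i hi
  have hj' := hs _ (subset_convexHull ℝ _ ⟨_, ⟨j, hj, rfl⟩, rfl⟩)
  have key : ∀ k : Fin n → ℤ, f (fun s => ((∑ j, k j * m j s : ℤ) : ℝ)) =
      ∑ j, f (fun s => (m j s : ℝ)) * k j := by
    intro k
    have : (fun s => ((∑ j, k j * m j s : ℤ) : ℝ)) =
        ∑ j, (k j : ℝ) • (fun s => (m j s : ℝ)) := by
      funext s; simp
    rw [this, map_sum]
    exact Finset.sum_congr rfl fun j _ => by rw [map_smul, smul_eq_mul, mul_comm]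
  rw [key] at hj' hu
  linarith

/-! ### Criteria for semistability -/

theorem isClosed_projTopology {E : Type*} [AddCommGroup E] [Module ℂ E] (P : E → Prop)
    (hP : ∀ (a : ℂˣ) x, P (a • x) ↔ P x) (hc : IsClosed[moduleTopology ℂ E] {x | P x}) :
    IsClosed[projTopology E] {p : ℙ ℂ E | P p.rep} := by
  let := moduleTopology ℂ E
  rw [isClosed_coinduced]
  have : (fun x : {x : E // x ≠ 0} => Projectivization.mk ℂ x.1 x.2) ⁻¹' {p | P p.rep} =
      Subtype.val ⁻¹' {x | P x} := by
    ext x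
    obtain ⟨a, ha⟩ := Projectivization.exists_smul_eq_mk_rep ℂ x.1 x.2
    simp only [Set.mem_preimage, Set.mem_ofPred_eq]
    rw [← ha, hP]
  rw [this]
  exact hc.preimage continuous_induced_dom

theorem closure_projOrbit_subset {n : ℕ} {E : Type*} [AddCommGroup E] [Module ℂ E]
    (τ : Representation ℂ SL(n, ℂ) E) (x : E) (P : E → Prop)
    (hP : ∀ (a : ℂˣ) x, P (a • x) ↔ P x) (hc : IsClosed[moduleTopology ℂ E] {x | P x})
    (hx : ∀ g, P (τ g x)) :
    closure[projTopology E] (projOrbit τ x) ⊆ {p : ℙ ℂ E | P p.rep} := by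
  let := projTopology E
  refine closure_minimal ?_ (isClosed_projTopology P hP hc)
  rintro _ ⟨g, hg, rfl⟩
  obtain ⟨a, ha⟩ := Projectivization.exists_smul_eq_mk_rep ℂ _ hg
  rw [Set.mem_ofPred_eq, ← ha, hP]
  exact hx g

/-- Both `‖x‖ ≤ C ‖y‖` and `‖y‖ ≤ 0` are closed and invariant under scaling, so they pass to the
respective orbit closures; together they leave only the zero vector. -/
theorem semistable_of_le {n : ℕ} {V W ι κ : Type*} [AddCommGroup V] [Module ℂ V]
    [AddCommGroup W] [Module ℂ W] [Fintype ι] [Fintype κ]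
    {ρ : Representation ℂ SL(n, ℂ) V} {σ : Representation ℂ SL(n, ℂ) W}
    (bV : Module.Basis ι ℂ V) (bW : Module.Basis κ ℂ W) {v : V} {w : W} (C : ℝ)
    (h : ∀ g, ∑ i, ‖bV.coord i (ρ g v)‖ ≤ C * ∑ j, ‖bW.coord j (σ g w)‖) :
    Semistable ρ σ v w := by
  have hcont : ∀ ψ : Module.Dual ℂ (V × W), Continuous[moduleTopology ℂ (V × W), _] ψ := by
    intro ψ
    let := moduleTopology ℂ (V × W)
    have : IsModuleTopology ℂ (V × W) := ⟨rfl⟩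
    exact IsModuleTopology.continuous_of_linearMap ψ
  have h1 := closure_projOrbit_subset (ρ.prod σ) (v, w)
    (fun x => ∑ i, ‖bV.coord i x.1‖ ≤ C * ∑ j, ‖bW.coord j x.2‖) (by
      intro a x
      have ha : 0 < ‖(a : ℂ)‖ := by simp
      simp only [Prod.smul_fst, Prod.smul_snd, Units.smul_def, map_smul, norm_smul,
        ← Finset.mul_sum, mul_left_comm C]
      exact mul_le_mul_iff_right₀ ha) (by
      let := moduleTopology ℂ (V × W)
      refine isClosed_le (continuous_finsetSum _ fun i _ => ?_)
        (continuous_const.mul (continuous_finsetSum _ fun j _ => ?_))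
      · exact (hcont (bV.coord i ∘ₗ LinearMap.fst ℂ V W)).norm
      · exact (hcont (bW.coord j ∘ₗ LinearMap.snd ℂ V W)).norm) (fun g => by simpa using h g)
  have h2 := closure_projOrbit_subset (ρ.prod σ) (v, 0)
    (fun x => ∑ j, ‖bW.coord j x.2‖ ≤ 0) (by
      intro a x
      have ha : 0 < ‖(a : ℂ)‖ := by simp
      simp only [Prod.smul_snd, Units.smul_def, map_smul, norm_smul, ← Finset.mul_sum]
      rw [← mul_zero ‖(a : ℂ)‖, mul_le_mul_iff_right₀ ha, mul_zero]) (by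
      let := moduleTopology ℂ (V × W)
      refine isClosed_le (continuous_finsetSum _ fun j _ => ?_) continuous_const
      exact (hcont (bW.coord j ∘ₗ LinearMap.snd ℂ V W)).norm) (fun g => by simp)
  rw [Semistable, Set.eq_empty_iff_forall_notMem]
  rintro p ⟨hp1, hp2⟩
  have hp1 : ∑ i, ‖bV.coord i p.rep.1‖ ≤ C * ∑ j, ‖bW.coord j p.rep.2‖ := h1 hp1
  have hp2 : ∑ j, ‖bW.coord j p.rep.2‖ ≤ 0 := h2 hp2
  have e2 : ∑ j, ‖bW.coord j p.rep.2‖ = 0 :=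
    le_antisymm hp2 (Finset.sum_nonneg fun _ _ => norm_nonneg _)
  have e1 : ∑ i, ‖bV.coord i p.rep.1‖ = 0 := by
    rw [e2, mul_zero] at hp1
    exact le_antisymm hp1 (Finset.sum_nonneg fun _ _ => norm_nonneg _)
  rw [Finset.sum_eq_zero_iff_of_nonneg (fun _ _ => norm_nonneg _)] at e1 e2
  refine p.rep_nonzero (Prod.ext ?_ ?_)
  · exact bV.ext_elem fun i => by simpa using e1 i (Finset.mem_univ _)
  · exact bW.ext_elem fun i => by simpa using e2 i (Finset.mem_univ _)

theorem mem_closure_projOrbit {n : ℕ} {E : Type*} [AddCommGroup E] [Module ℂ E]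
    [FiniteDimensional ℂ E] (τ : Representation ℂ SL(n, ℂ) E) (x y : E) (hy : y ≠ 0)
    {α : Type*} (l : Filter α) [l.NeBot] (a : α → ℂˣ) (g : α → SL(n, ℂ))
    (h : ∀ ψ : Module.Dual ℂ E,
      Filter.Tendsto (fun k => ψ ((a k : ℂ) • τ (g k) x)) l (𝓝 (ψ y))) :
    Projectivization.mk ℂ y hy ∈ closure[projTopology E] (projOrbit τ x) := by
  let := moduleTopology ℂ E
  have : IsModuleTopology ℂ E := ⟨rfl⟩
  have : ContinuousAdd E := IsModuleTopology.toContinuousAdd ℂ E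
  have : ContinuousSMul ℂ E := ModuleTopology.continuousSMul ℂ E
  let := projTopology E
  have hx : ∀ k, (a k : ℂ) • τ (g k) x ≠ 0 := by
    intro k hk
    have hx0 : x = 0 := by
      have h1 : τ (g k) x = 0 := (smul_eq_zero.1 hk).resolve_left (Units.ne_zero _)
      have := congrArg (τ (g k)⁻¹) h1
      rwa [map_zero, ← Module.End.mul_apply, ← map_mul, inv_mul_cancel, map_one] at this
    refine hy ((Module.forall_dual_apply_eq_zero_iff ℂ y).1 fun ψ => ?_)
    have := h ψ
    simp only [hx0, map_zero, smul_zero] at this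
    exact (tendsto_nhds_unique tendsto_const_nhds this).symm
  have ht : Filter.Tendsto (fun k => (a k : ℂ) • τ (g k) x) l (𝓝 y) := by
    let b := Module.finBasis ℂ E
    have : Filter.Tendsto (fun k => ∑ i, b.coord i ((a k : ℂ) • τ (g k) x) • b i) l
        (𝓝 (∑ i, b.coord i y • b i)) :=
      tendsto_finsetSum _ fun i _ => (h (b.coord i)).smul_const (b i)
    simpa only [Module.Basis.coord_apply, b.sum_repr] using this
  have ht' : Filter.Tendsto (fun k => (⟨_, hx k⟩ : {x : E // x ≠ 0})) l (𝓝 ⟨y, hy⟩) :=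
    tendsto_subtype_rng.2 ht
  have hc : Continuous (fun x : {x : E // x ≠ 0} => Projectivization.mk ℂ x.1 x.2) :=
    continuous_coinduced_rng
  refine mem_closure_of_tendsto ((hc.tendsto _).comp ht') (Filter.Eventually.of_forall fun k => ?_)
  refine ⟨g k, fun h0 => hx k (by rw [h0, smul_zero]), ?_⟩
  exact (Projectivization.mk_eq_mk_iff ℂ _ _ _ _).2 ⟨a k, rfl⟩

/-- The same scalars and group elements move both `(v, w)` and `(v, 0)` to `(y, 0)`, so `[(y, 0)]`
lies in both closures. -/
theorem not_semistable_of_tendsto {n : ℕ} {V W : Type*} [AddCommGroup V] [Module ℂ V]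
    [AddCommGroup W] [Module ℂ W] [FiniteDimensional ℂ V] [FiniteDimensional ℂ W]
    {ρ : Representation ℂ SL(n, ℂ) V} {σ : Representation ℂ SL(n, ℂ) W}
    {v : V} {w : W} {y : V} (hy : y ≠ 0)
    {α : Type*} (l : Filter α) [l.NeBot] (a : α → ℂˣ) (g : α → SL(n, ℂ))
    (hv : ∀ ψ : Module.Dual ℂ V,
      Filter.Tendsto (fun k => ψ ((a k : ℂ) • ρ (g k) v)) l (𝓝 (ψ y)))
    (hw : ∀ ψ : Module.Dual ℂ W,
      Filter.Tendsto (fun k => ψ ((a k : ℂ) • σ (g k) w)) l (𝓝 0)) :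
    ¬ Semistable ρ σ v w := by
  have hy' : ((y, 0) : V × W) ≠ 0 := fun h => hy (congrArg Prod.fst h)
  have hdual : ∀ (ψ : Module.Dual ℂ (V × W)) (p : V) (q : W),
      ψ (p, q) = (ψ ∘ₗ LinearMap.inl ℂ V W) p + (ψ ∘ₗ LinearMap.inr ℂ V W) q := by
    intro ψ p q
    rw [LinearMap.comp_apply, LinearMap.comp_apply, ← map_add]
    simp
  intro hs
  refine (Set.eq_empty_iff_forall_notMem.1 hs (Projectivization.mk ℂ _ hy')) ⟨?_, ?_⟩
  · refine mem_closure_projOrbit (ρ.prod σ) _ _ hy' l a g fun ψ => ?_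
    have := (hv (ψ ∘ₗ LinearMap.inl ℂ V W)).add (hw (ψ ∘ₗ LinearMap.inr ℂ V W))
    rw [hdual, map_zero]
    refine this.congr fun k => ?_
    exact (hdual _ _ _).symm
  · refine mem_closure_projOrbit (ρ.prod σ) _ _ hy' l a g fun ψ => ?_
    have := (hv (ψ ∘ₗ LinearMap.inl ℂ V W)).add
      (tendsto_const_nhds (x := (ψ ∘ₗ LinearMap.inr ℂ V W) 0))
    rw [hdual]
    refine this.congr fun k => ?_
    rw [← hdual]
    simp


/-! ### Symmetric powers: linear substitutions, rationality and weights -/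

/-- The substitution `X j ↦ ∑ i, M i j X i` of linear forms. -/
def substMatrix {n : ℕ} (M : Matrix (Fin n) (Fin n) ℂ) :
    MvPolynomial (Fin n) ℂ →ₐ[ℂ] MvPolynomial (Fin n) ℂ :=
  MvPolynomial.aeval fun j => ∑ i, M i j • MvPolynomial.X i

theorem substMatrix_mem {n : ℕ} (d : ℕ) (M : Matrix (Fin n) (Fin n) ℂ) (p : MvPolynomial (Fin n) ℂ)
    (hp : p ∈ MvPolynomial.homogeneousSubmodule (Fin n) ℂ d) :
    substMatrix M p ∈ MvPolynomial.homogeneousSubmodule (Fin n) ℂ d := by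
  rw [MvPolynomial.mem_homogeneousSubmodule] at hp ⊢
  have h := hp.aeval (n := 1) (fun j => ∑ i, M i j • (MvPolynomial.X i : MvPolynomial (Fin n) ℂ))
    (fun j => MvPolynomial.IsHomogeneous.sum _ _ _ fun i _ =>
      (MvPolynomial.homogeneousSubmodule (Fin n) ℂ 1).smul_mem _ (MvPolynomial.isHomogeneous_X ℂ i))
  rwa [one_mul] at h

/-- The linear endomorphism of `Sym^d ℂ^n` induced by an endomorphism of `ℂ^n`. -/
def symMap {n d : ℕ} (M : Matrix (Fin n) (Fin n) ℂ) : Sym n d →ₗ[ℂ] Sym n d :=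
  (substMatrix M).toLinearMap.restrict (substMatrix_mem d M)

theorem symRep_eq_symMap {n d : ℕ} (g : SL(n, ℂ)) (p : Sym n d) :
    symRep n d g p = symMap (g : Matrix (Fin n) (Fin n) ℂ) p := rfl

theorem coe_symMap {n d : ℕ} (M : Matrix (Fin n) (Fin n) ℂ) (p : Sym n d) :
    (symMap M p : MvPolynomial (Fin n) ℂ) = substMatrix M p := rfl

theorem substMatrix_X {n : ℕ} (M : Matrix (Fin n) (Fin n) ℂ) (j : Fin n) :
    substMatrix M (MvPolynomial.X j) = ∑ i, M i j • MvPolynomial.X i := by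
  simp [substMatrix]

instance (n d : ℕ) : FiniteDimensional ℂ (Sym n d) :=
  Module.Finite.iff_fg.2 (MvPolynomial.homogeneousSubmodule_fg (Fin n) ℂ d)

theorem exists_eval_eq_coeff_substMatrix {n : ℕ} (p : MvPolynomial (Fin n) ℂ) (m : Fin n →₀ ℕ) :
    ∃ P : MvPolynomial (Fin n × Fin n) ℂ, ∀ M : Matrix (Fin n) (Fin n) ℂ,
      (substMatrix M p).coeff m = MvPolynomial.eval (fun ij => M ij.1 ij.2) P := by
  classical
  induction p using MvPolynomial.induction_on generalizing m with
  | C a =>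
    exact ⟨MvPolynomial.C ((MvPolynomial.C a : MvPolynomial (Fin n) ℂ).coeff m), fun M => by
      simp [substMatrix, MvPolynomial.algebraMap_eq]⟩
  | add p q hp hq =>
    obtain ⟨P, hP⟩ := hp m
    obtain ⟨Q, hQ⟩ := hq m
    exact ⟨P + Q, fun M => by simp [hP, hQ]⟩
  | mul_X p j hp =>
    choose P hP using hp
    refine ⟨∑ x ∈ Finset.HasAntidiagonal.antidiagonal m, P x.1 * ∑ i, MvPolynomial.X (i, j) *
      MvPolynomial.C ((MvPolynomial.X i : MvPolynomial (Fin n) ℂ).coeff x.2), fun M => ?_⟩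
    simp [MvPolynomial.coeff_mul, hP, substMatrix_X, MvPolynomial.coeff_sum]

/-- The matrix coefficients of `Sym^d` are polynomial. -/
theorem exists_eval_eq_dual_symMap {n d : ℕ} (ψ : Module.Dual ℂ (Sym n d)) (p : Sym n d) :
    ∃ P : MvPolynomial (Fin n × Fin n) ℂ, ∀ M : Matrix (Fin n) (Fin n) ℂ,
      ψ (symMap M p) = MvPolynomial.eval (fun ij => M ij.1 ij.2) P := by
  let coord : (Fin n →₀ ℕ) → Module.Dual ℂ (Sym n d) := fun m =>
    (MvPolynomial.lcoeff ℂ m) ∘ₗ Submodule.subtype _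
  -- In finite dimension, forms that separate points span the dual.
  have hspan : ψ ∈ Submodule.span ℂ (Set.range coord) := by
    have hbot : (Submodule.span ℂ (Set.range coord)).dualCoannihilator = ⊥ := by
      rw [eq_bot_iff]
      intro q hq
      rw [Submodule.mem_dualCoannihilator] at hq
      refine Subtype.ext (MvPolynomial.ext _ _ fun m => ?_)
      exact hq _ (Submodule.subset_span ⟨m, rfl⟩)
    have := Subspace.dualCoannihilator_dualAnnihilator_eq
      (W := Submodule.span ℂ (Set.range coord))
    rw [hbot] at this
    rw [← this]
    simp
  induction hspan using Submodule.span_induction with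
  | mem ψ h =>
    obtain ⟨m, rfl⟩ := h
    exact exists_eval_eq_coeff_substMatrix p.1 m
  | zero => exact ⟨0, by simp⟩
  | add ψ χ _ _ h1 h2 =>
    obtain ⟨P, hP⟩ := h1
    obtain ⟨Q, hQ⟩ := h2
    exact ⟨P + Q, fun M => by simp [hP, hQ]⟩
  | smul a ψ _ h1 =>
    obtain ⟨P, hP⟩ := h1
    exact ⟨MvPolynomial.C a * P, fun M => by simp [hP]⟩

theorem continuous_dual_symMap {n d : ℕ} (ψ : Module.Dual ℂ (Sym n d)) (p : Sym n d) :
    Continuous fun M : Matrix (Fin n) (Fin n) ℂ => ψ (symMap M p) := by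
  obtain ⟨P, hP⟩ := exists_eval_eq_dual_symMap ψ p
  simp only [hP]
  refine (MvPolynomial.continuous_eval P).comp (continuous_pi fun ij => ?_)
  exact continuous_id.matrix_elem ij.1 ij.2

theorem isRational_symRep (n d : ℕ) : IsRational (symRep n d) := by
  refine ⟨inferInstance, fun φ v => ?_⟩
  obtain ⟨P, hP⟩ := exists_eval_eq_dual_symMap φ v
  exact ⟨P, fun g => hP g⟩

theorem IsRational.prod {n : ℕ} {V W : Type*} [AddCommGroup V] [Module ℂ V]
    [AddCommGroup W] [Module ℂ W] {ρ : Representation ℂ SL(n, ℂ) V}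
    {σ : Representation ℂ SL(n, ℂ) W} (hρ : IsRational ρ) (hσ : IsRational σ) :
    IsRational (ρ.prod σ) := by
  have := hρ.1
  have := hσ.1
  refine ⟨inferInstance, fun φ v => ?_⟩
  obtain ⟨P, hP⟩ := hρ.2 (φ ∘ₗ LinearMap.inl ℂ V W) v.1
  obtain ⟨Q, hQ⟩ := hσ.2 (φ ∘ₗ LinearMap.inr ℂ V W) v.2
  refine ⟨P + Q, fun g => ?_⟩
  rw [map_add, ← hP, ← hQ, LinearMap.comp_apply, LinearMap.comp_apply, ← map_add]
  simp

/-- The automorphism `g ↦ (g⁻¹)ᵀ` of `SL(n, ℂ)`. -/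
def contragredient (n : ℕ) : SL(n, ℂ) →* SL(n, ℂ) where
  toFun g := g⁻¹.transpose
  map_one' := by ext i j; simp [Matrix.one_apply, eq_comm]
  map_mul' g h := by
    ext i j
    simp only [mul_inv_rev, Matrix.SpecialLinearGroup.coe_transpose,
      Matrix.SpecialLinearGroup.coe_mul, Matrix.transpose_mul]

theorem contragredient_contragredient {n : ℕ} (g : SL(n, ℂ)) :
    contragredient n (contragredient n g) = g := by
  have h1 : (contragredient n g)⁻¹ = contragredient n g⁻¹ := (map_inv _ _).symm
  change (contragredient n g)⁻¹.transpose = g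
  rw [h1]
  ext i j
  simp [contragredient]

theorem coe_contragredient {n : ℕ} (g : SL(n, ℂ)) :
    (contragredient n g : Matrix (Fin n) (Fin n) ℂ) =
      (g : Matrix (Fin n) (Fin n) ℂ).adjugate.transpose := by
  simp [contragredient]

/-- On determinant one matrices the entries of the inverse transpose are cofactors, hence
polynomial. -/
theorem IsRational.comp_contragredient {n : ℕ} {V : Type*} [AddCommGroup V] [Module ℂ V]
    {ρ : Representation ℂ SL(n, ℂ) V} (hρ : IsRational ρ) :
    IsRational (MonoidHom.comp ρ (contragredient n) : Representation ℂ SL(n, ℂ) V) := by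
  refine ⟨hρ.1, fun φ v => ?_⟩
  obtain ⟨P, hP⟩ := hρ.2 φ v
  refine ⟨MvPolynomial.bind₁ (fun ij : Fin n × Fin n =>
    (Matrix.mvPolynomialX (Fin n) (Fin n) ℂ).adjugate ij.2 ij.1) P, fun g => ?_⟩
  change φ (ρ (contragredient n g) v) = _
  rw [hP]
  refine Eq.trans ?_ (MvPolynomial.eval₂Hom_bind₁ (RingHom.id ℂ) _ _ P).symm
  change MvPolynomial.eval _ P = MvPolynomial.eval _ P
  congr 2
  funext ij
  rw [coe_contragredient, Matrix.transpose_apply]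
  have h := RingHom.map_adjugate (MvPolynomial.eval fun ij : Fin n × Fin n => g ij.1 ij.2)
    (Matrix.mvPolynomialX (Fin n) (Fin n) ℂ)
  have h2 : (MvPolynomial.eval fun ij : Fin n × Fin n => g ij.1 ij.2).mapMatrix
      (Matrix.mvPolynomialX (Fin n) (Fin n) ℂ) = (g : Matrix (Fin n) (Fin n) ℂ) := by
    ext i j; simp
  rw [h2] at h
  exact (congrFun (congrFun h ij.2) ij.1).symm

/-- The coefficients of a homogeneous polynomial, as linear forms on `Sym^d ℂ^n`. -/
def symCoord (n d : ℕ) (m : Fin n →₀ ℕ) : Module.Dual ℂ (Sym n d) :=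
  MvPolynomial.lcoeff ℂ m ∘ₗ Submodule.subtype _

theorem symCoord_apply {n d : ℕ} (m : Fin n →₀ ℕ) (p : Sym n d) :
    symCoord n d m p = p.1.coeff m := rfl

theorem coeff_substMatrix_diagonal {n : ℕ} (a : Fin n → ℂ) (p : MvPolynomial (Fin n) ℂ)
    (m : Fin n →₀ ℕ) :
    (substMatrix (Matrix.diagonal a) p).coeff m = (∏ j, a j ^ m j) * p.coeff m := by
  classical
  induction p using MvPolynomial.induction_on' with
  | add p q hp hq => simp [hp, hq, mul_add]
  | monomial u c =>
    have h : substMatrix (Matrix.diagonal a) (MvPolynomial.monomial u c) =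
        MvPolynomial.C (∏ j, a j ^ u j) * MvPolynomial.monomial u c := by
      simp only [substMatrix, MvPolynomial.aeval_monomial, Matrix.diagonal_apply, ite_smul,
        zero_smul, Finset.sum_ite_eq', Finset.mem_univ, if_true, MvPolynomial.algebraMap_eq]
      rw [Finsupp.prod_fintype _ _ (by simp)]
      simp only [MvPolynomial.smul_eq_C_mul, Finset.prod_mul_distrib, mul_pow,
        map_prod, map_pow]
      rw [MvPolynomial.monomial_eq, Finsupp.prod_fintype _ _ (by simp)]
      ring
    rw [h, MvPolynomial.coeff_C_mul, MvPolynomial.coeff_monomial]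
    split_ifs with hu
    · rw [hu]
    · simp

theorem isWeightCoord_symRep (n d : ℕ) :
    IsWeightCoord (symRep n d) (symCoord n d) (fun m j => (m j : ℤ)) where
  eq_zero x hx := Subtype.ext (MvPolynomial.ext _ _ hx)
  finite x := by
    refine (x.1.support.finite_toSet).subset fun m hm => ?_
    simpa [symCoord_apply] using hm
  weight g a hg m x := by
    have h := coeff_substMatrix_diagonal a x.1 m
    rw [← hg] at h
    simp only [zpow_natCast]
    exact h

/-- Weights of the diagonal torus matter only modulo `(1, …, 1)`. Shifting gives `V` and `W` the
same total degree, so that support functions can be compared for every `l`, not only those of sum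
zero. -/
theorem IsWeightCoord.add_const {n : ℕ} {V ι : Type*} [AddCommGroup V] [Module ℂ V]
    {ρ : Representation ℂ SL(n, ℂ) V} {coord : ι → Module.Dual ℂ V} {wt : ι → Fin n → ℤ}
    (h : IsWeightCoord ρ coord wt) (c : ℤ) : IsWeightCoord ρ coord (fun i j => wt i j + c) where
  eq_zero := h.eq_zero
  finite := h.finite
  weight d a hd i x := by
    have hdet : ∏ j, a j = 1 := by
      have := d.2
      rwa [hd, Matrix.det_diagonal] at this
    have ha : ∀ j, a j ≠ 0 := fun j hj => by
      rw [Finset.prod_eq_zero (Finset.mem_univ j) hj] at hdet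
      exact zero_ne_one hdet
    rw [h.weight d a hd]
    simp_rw [zpow_add₀ (ha _), Finset.prod_mul_distrib, Finset.prod_zpow, hdet]
    simp

theorem IsWeightCoord.prod {n : ℕ} {V W ι κ : Type*} [AddCommGroup V] [Module ℂ V]
    [AddCommGroup W] [Module ℂ W]
    {ρ : Representation ℂ SL(n, ℂ) V} {cV : ι → Module.Dual ℂ V} {wV : ι → Fin n → ℤ}
    {σ : Representation ℂ SL(n, ℂ) W} {cW : κ → Module.Dual ℂ W} {wW : κ → Fin n → ℤ}
    (hV : IsWeightCoord ρ cV wV) (hW : IsWeightCoord σ cW wW) :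
    IsWeightCoord (ρ.prod σ)
      (Sum.elim (fun i => cV i ∘ₗ LinearMap.fst ℂ V W) (fun i => cW i ∘ₗ LinearMap.snd ℂ V W))
      (Sum.elim wV wW) where
  eq_zero x hx := Prod.ext (hV.eq_zero _ fun i => hx (Sum.inl i))
    (hW.eq_zero _ fun i => hx (Sum.inr i))
  finite x := by
    refine (((hV.finite x.1).image Sum.inl).union ((hW.finite x.2).image Sum.inr)).subset ?_
    rintro (i | i) hi
    · exact Or.inl ⟨i, hi, rfl⟩
    · exact Or.inr ⟨i, hi, rfl⟩
  weight d a hd i x := by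
    rcases i with i | i
    · exact hV.weight d a hd i x.1
    · exact hW.weight d a hd i x.2

theorem IsWeightCoord.comp_contragredient {n : ℕ} {V ι : Type*} [AddCommGroup V] [Module ℂ V]
    {ρ : Representation ℂ SL(n, ℂ) V} {coord : ι → Module.Dual ℂ V} {wt : ι → Fin n → ℤ}
    (h : IsWeightCoord ρ coord wt) :
    IsWeightCoord (MonoidHom.comp ρ (contragredient n) : Representation ℂ SL(n, ℂ) V) coord
      (fun i j => -wt i j) where
  eq_zero := h.eq_zero
  finite := h.finite
  weight d a hd i x := by
    have hdet : ∏ j, a j = 1 := by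
      have := d.2
      rwa [hd, Matrix.det_diagonal] at this
    have ha : ∀ j, a j ≠ 0 := fun j hj => by
      rw [Finset.prod_eq_zero (Finset.mem_univ j) hj] at hdet
      exact zero_ne_one hdet
    have hc : (contragredient n d : Matrix (Fin n) (Fin n) ℂ) =
        Matrix.diagonal fun j => (a j)⁻¹ := by
      have h1 : (d : Matrix (Fin n) (Fin n) ℂ)⁻¹ = Matrix.diagonal fun j => (a j)⁻¹ := by
        rw [hd]
        refine Matrix.inv_eq_right_inv ?_
        rw [Matrix.diagonal_mul_diagonal]
        simp [ha]
      rw [coe_contragredient, ← Matrix.diagonal_transpose, ← h1, Matrix.inv_def, d.2]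
      simp
    have := h.weight (contragredient n d) _ hc i x
    simpa using this


/-! ### The pair `e₁ e₂^(n-1)`, `e₁^n + e₂^(n-2)` for `SL(2, ℂ)` -/

theorem not_isIrreducible_prod {n : ℕ} {V W : Type*} [AddCommGroup V] [Module ℂ V]
    [AddCommGroup W] [Module ℂ W] (ρ : Representation ℂ SL(n, ℂ) V)
    (σ : Representation ℂ SL(n, ℂ) W) {v : V} {w : W} (hv : v ≠ 0) (hw : w ≠ 0) :
    ¬ (ρ.prod σ).IsIrreducible := by
  intro h
  let U : Subrepresentation (ρ.prod σ) :=
    { toSubmodule := Submodule.prod ⊤ ⊥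
      apply_mem_toSubmodule := by
        rintro g ⟨x, y⟩ ⟨_, hy⟩
        refine ⟨trivial, ?_⟩
        rw [SetLike.mem_coe, Submodule.mem_bot] at hy ⊢
        simp only at hy
        simp [hy] }
  rcases h.eq_bot_or_eq_top U with hU | hU
  · have h1 : ((v, 0) : V × W) ∈ U.toSubmodule := ⟨trivial, rfl⟩
    rw [hU] at h1
    exact hv (congrArg Prod.fst ((Submodule.mem_bot ℂ).1 h1))
  · have h1 : ((0, w) : V × W) ∈ U.toSubmodule := by rw [hU]; trivial
    exact hw ((Submodule.mem_bot ℂ).1 h1.2)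

/-- Shows that a power of a linear form attains the vertex `d • e_i` of the simplex as soon as its
`i`-th coefficient is nonzero. -/
theorem coeff_single_linearForm_pow {n : ℕ} (a : Fin n → ℂ) (i : Fin n) (d : ℕ) :
    ((∑ k, a k • MvPolynomial.X k : MvPolynomial (Fin n) ℂ) ^ d).coeff (Finsupp.single i d) =
      a i ^ d := by
  rw [MvPolynomial.coeff_linearCombination_X_pow_of_fintype, Finsupp.multinomial,
    Finsupp.sum_single_index rfl, Finsupp.prod_single_index rfl, Finsupp.prod_single_index (by simp),
    if_pos rfl, Finsupp.sum_single_index (h := fun _ => id) rfl, id, Nat.div_self (Nat.factorial_pos d), Nat.cast_one, one_mul]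

theorem Sym.sum_eq_of_coeff_ne_zero {n d : ℕ} (p : Sym n d) {m : Fin n →₀ ℕ}
    (h : p.1.coeff m ≠ 0) : ∑ i, m i = d := by
  have := ((MvPolynomial.mem_homogeneousSubmodule d p.1).1 p.2) h
  rw [Finsupp.weight_apply, Finsupp.sum_fintype _ _ (by simp)] at this
  simpa using this

theorem monomial₂_ne_zero {d : ℕ} (a b : ℕ) (h : a + b = d) : monomial₂ a b h ≠ 0 := by
  intro h0
  have : (MvPolynomial.X 0 ^ a * MvPolynomial.X 1 ^ b : MvPolynomial (Fin 2) ℂ) = 0 :=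
    congrArg Subtype.val h0
  simp at this

theorem substMatrix_monomial₂ {d : ℕ} (a b : ℕ) (h : a + b = d) (M : Matrix (Fin 2) (Fin 2) ℂ) :
    substMatrix M (monomial₂ a b h : MvPolynomial (Fin 2) ℂ) =
      (∑ i, M i 0 • MvPolynomial.X i) ^ a * (∑ i, M i 1 • MvPolynomial.X i) ^ b := by
  simp only [monomial₂, map_mul, map_pow, substMatrix_X]

theorem numericallySemistable_monomial₂ (n : ℕ) (hn : 3 ≤ n) (h1 : 1 + (n - 1) = n)
    (h2 : n + 0 = n) (h3 : 0 + (n - 2) = n - 2) :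
    NumericallySemistable (symRep 2 n) ((symRep 2 n).prod (symRep 2 (n - 2)))
      (monomial₂ 1 (n - 1) h1) (monomial₂ n 0 h2, monomial₂ 0 (n - 2) h3) := by
  refine numericallySemistable_of_support (isRational_symRep 2 n)
    ((isRational_symRep 2 n).prod (isRational_symRep 2 (n - 2))) (isWeightCoord_symRep 2 n)
    ((isWeightCoord_symRep 2 n).prod ((isWeightCoord_symRep 2 (n - 2)).add_const 1)) ?_
  intro g l m hm
  -- `i` is the index favoured by `l`; a monomial of degree `n` has value at most `n * l i`.
  obtain ⟨i, j, hij, hl, hs⟩ : ∃ i j : Fin 2, i ≠ j ∧ l j ≤ l i ∧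
      ∀ f : Fin 2 → ℝ, ∑ k, f k = f i + f j := by
    rcases le_total (l 0) (l 1) with h | h
    · exact ⟨1, 0, by simp, h, fun f => by rw [Fin.sum_univ_two, add_comm]⟩
    · exact ⟨0, 1, by simp, h, fun f => Fin.sum_univ_two f⟩
  rw [symCoord_apply] at hm
  have hdeg : (m i : ℝ) + m j = n := by
    have := Sym.sum_eq_of_coeff_ne_zero _ hm
    rw [← hs (fun k => (m k : ℝ))]
    exact_mod_cast this
  rw [symRep_eq_symMap, coe_symMap, substMatrix_monomial₂] at hm
  have hmi : (m i : ℝ) = n - m j := by linarith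
  have hmj : (0 : ℝ) ≤ m j := Nat.cast_nonneg _
  by_cases hg : g i 0 = 0
  · have hg1 : g i 1 ≠ 0 := by
      intro hg1
      have hdet := g.2
      rw [Matrix.det_eq_zero_of_row_eq_zero i] at hdet
      · exact zero_ne_one hdet
      · intro k
        fin_cases k
        · exact hg
        · exact hg1
    -- Here `g e₁` is a multiple of `e_j`, so every monomial of `g v` contains `e_j`.
    have hmj1 : 1 ≤ m j := by
      by_contra hmj0
      have e : (∑ k, g k 0 • MvPolynomial.X k : MvPolynomial (Fin 2) ℂ) =
          MvPolynomial.C (g j 0) * MvPolynomial.X j := by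
        have : ∀ f : Fin 2 → MvPolynomial (Fin 2) ℂ, ∑ k, f k = f i + f j := by
          intro f
          fin_cases i <;> fin_cases j <;> simp_all [add_comm]
        rw [this, hg, zero_smul, zero_add, MvPolynomial.smul_eq_C_mul]
      rw [e, pow_one, mul_assoc, MvPolynomial.coeff_C_mul, MvPolynomial.coeff_X_mul',
        if_neg (by simpa using hmj0), mul_zero] at hm
      exact hm rfl
    -- With the shift by one, `e_i^(n-2)` has value `(n - 1) * l i + l j`, exactly the maximum left
    -- to `g v`.
    refine ⟨Sum.inr (Finsupp.single i (n - 2)), ?_, ?_⟩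
    · have : (substMatrix (g : Matrix (Fin 2) (Fin 2) ℂ)
          (monomial₂ 0 (n - 2) h3 : MvPolynomial (Fin 2) ℂ)).coeff
            (Finsupp.single i (n - 2)) ≠ 0 := by
        rw [substMatrix_monomial₂, pow_zero, one_mul, coeff_single_linearForm_pow]
        exact pow_ne_zero _ hg1
      exact this
    · have hmj1' : (1 : ℝ) ≤ m j := by exact_mod_cast hmj1
      have hn2 : ((n - 2 : ℕ) : ℝ) = n - 2 := by
        rw [Nat.cast_sub (by omega)]; simp
      rw [hs, hs]
      simp only [Sum.elim_inr, Finsupp.single_eq_same, Finsupp.single_eq_of_ne hij.symm]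
      push_cast
      rw [hn2, hmi]
      nlinarith [mul_nonneg (sub_nonneg.2 hl) (sub_nonneg.2 hmj1')]
  · refine ⟨Sum.inl (Finsupp.single i n), ?_, ?_⟩
    · have : (substMatrix (g : Matrix (Fin 2) (Fin 2) ℂ)
          (monomial₂ n 0 h2 : MvPolynomial (Fin 2) ℂ)).coeff (Finsupp.single i n) ≠ 0 := by
        rw [substMatrix_monomial₂, pow_zero, mul_one, coeff_single_linearForm_pow]
        exact pow_ne_zero _ hg
      exact this
    · rw [hs, hs]
      simp only [Sum.elim_inl, Finsupp.single_eq_same, Finsupp.single_eq_of_ne hij.symm]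
      push_cast
      rw [hmi]
      nlinarith [mul_nonneg (sub_nonneg.2 hl) hmj]

/-- Under the unipotent `g` with entry `t⁻¹`, `e₁` is fixed and `t · g e₂ = e₁ + t e₂`. Scaled by
`t^(n-1)`, `g v` tends to `e₁^n`, while the components of `g w` become `t^(n-1) e₁^n` and `t (ẽ₁ + t
ẽ₂)^(n-2)`, which tend to `0`. -/
theorem not_semistable_monomial₂ (n : ℕ) (hn : 3 ≤ n) (h1 : 1 + (n - 1) = n)
    (h2 : n + 0 = n) (h3 : 0 + (n - 2) = n - 2) :
    ¬ Semistable (symRep 2 n) ((symRep 2 n).prod (symRep 2 (n - 2)))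
      (monomial₂ 1 (n - 1) h1) (monomial₂ n 0 h2, monomial₂ 0 (n - 2) h3) := by
  let t : ℕ → ℂ := fun k => 1 / ((k : ℂ) + 1)
  have ht : Filter.Tendsto t Filter.atTop (𝓝 0) := tendsto_one_div_add_atTop_nhds_zero_nat
  have ht0 : ∀ k, t k ≠ 0 := fun k => one_div_ne_zero (by exact_mod_cast Nat.succ_ne_zero k)
  let g : ℕ → SL(2, ℂ) := fun k => ⟨!![1, (t k)⁻¹; 0, 1], by simp [Matrix.det_fin_two]⟩
  -- The matrix of `g` with its second column multiplied by `t`; unlike `g`, it extends continuously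
  -- to `t = 0`.
  let M : ℂ → Matrix (Fin 2) (Fin 2) ℂ := fun t => !![1, 1; 0, t]
  have hM : Continuous M := by
    refine continuous_matrix fun i j => ?_
    fin_cases i <;> fin_cases j <;> simp [M] <;> fun_prop
  have hlim : ∀ {d : ℕ} (ψ : Module.Dual ℂ (Sym 2 d)) (p : Sym 2 d),
      Filter.Tendsto (fun k => ψ (symMap (M (t k)) p)) Filter.atTop (𝓝 (ψ (symMap (M 0) p))) :=
    fun ψ p => (((continuous_dual_symMap ψ p).comp hM).tendsto 0).comp ht
  have hline : ∀ k, MvPolynomial.C (t k) *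
      (∑ i, (g k : Matrix (Fin 2) (Fin 2) ℂ) i 1 • MvPolynomial.X i : MvPolynomial (Fin 2) ℂ) =
        ∑ i, M (t k) i 1 • MvPolynomial.X i := by
    intro k
    simp only [g, M, Fin.sum_univ_two, MvPolynomial.smul_eq_C_mul, mul_add, ← mul_assoc,
      ← MvPolynomial.C_mul]
    simp [ht0 k]
  have hline0 : ∀ k,
      (∑ i, (g k : Matrix (Fin 2) (Fin 2) ℂ) i 0 • MvPolynomial.X i : MvPolynomial (Fin 2) ℂ) =
        ∑ i, M (t k) i 0 • MvPolynomial.X i := by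
    intro k
    simp [g, M, Fin.sum_univ_two]
  refine not_semistable_of_tendsto (y := symMap (M 0) (monomial₂ 1 (n - 1) h1)) ?_ Filter.atTop
    (fun k => Units.mk0 (t k ^ (n - 1)) (pow_ne_zero _ (ht0 k))) g (fun ψ => ?_) fun ψ => ?_
  · intro h
    have h' := congrArg Subtype.val h
    rw [coe_symMap, substMatrix_monomial₂] at h'
    simp [M, Fin.sum_univ_two] at h'
  · refine (hlim ψ _).congr fun k => ?_
    congr 1
    refine Subtype.ext ?_
    rw [Submodule.coe_smul, symRep_eq_symMap, coe_symMap, coe_symMap, substMatrix_monomial₂,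
      substMatrix_monomial₂, MvPolynomial.smul_eq_C_mul, ← hline, ← hline0, mul_pow,
      Units.val_mk0, map_pow]
    ring
  · have e1 : ∀ k, symRep 2 n (g k) (monomial₂ n 0 h2) = monomial₂ n 0 h2 := by
      intro k
      refine Subtype.ext ?_
      rw [symRep_eq_symMap, coe_symMap, substMatrix_monomial₂]
      simp [g, Fin.sum_univ_two, monomial₂]
    have e2 : ∀ k, t k ^ (n - 1) • symRep 2 (n - 2) (g k) (monomial₂ 0 (n - 2) h3) =
        t k • symMap (M (t k)) (monomial₂ 0 (n - 2) h3) := by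
      intro k
      refine Subtype.ext ?_
      rw [Submodule.coe_smul, Submodule.coe_smul, symRep_eq_symMap, coe_symMap, coe_symMap,
        substMatrix_monomial₂, substMatrix_monomial₂, MvPolynomial.smul_eq_C_mul,
        MvPolynomial.smul_eq_C_mul, ← hline, mul_pow, show n - 1 = (n - 2) + 1 by omega, pow_succ,
        map_mul, map_pow]
      ring
    have e3 : ∀ k, ψ (t k ^ (n - 1) • ((symRep 2 n).prod (symRep 2 (n - 2))) (g k)
        (monomial₂ n 0 h2, monomial₂ 0 (n - 2) h3)) =
        t k ^ (n - 1) * (ψ ∘ₗ LinearMap.inl ℂ _ _) (monomial₂ n 0 h2) +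
        t k * (ψ ∘ₗ LinearMap.inr ℂ _ _) (symMap (M (t k)) (monomial₂ 0 (n - 2) h3)) := by
      intro k
      have e4 := congrArg (ψ ∘ₗ LinearMap.inr ℂ (Sym 2 n) (Sym 2 (n - 2))) (e2 k)
      rw [map_smul, map_smul, smul_eq_mul, smul_eq_mul] at e4
      rw [← e4, map_smul, smul_eq_mul, ← mul_add, LinearMap.comp_apply, LinearMap.comp_apply,
        ← map_add]
      congr 2
      simp [e1]
    simp only [Units.val_mk0, e3]
    have l1 := (ht.pow (n - 1)).mul_const
      ((ψ ∘ₗ LinearMap.inl ℂ (Sym 2 n) (Sym 2 (n - 2))) (monomial₂ n 0 h2))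
    have l2 := ht.mul (hlim (ψ ∘ₗ LinearMap.inr ℂ (Sym 2 n) (Sym 2 (n - 2)))
      (monomial₂ 0 (n - 2) h3))
    have := l1.add l2
    rwa [zero_pow (by omega), zero_mul, zero_mul, add_zero] at this


/-! ### Irreducibility of the symmetric powers -/

theorem isIrreducible_of_dual {n : ℕ} {V : Type*} [AddCommGroup V] [Module ℂ V]
    (ρ : Representation ℂ SL(n, ℂ) V) {v₀ : V} (hv₀ : v₀ ≠ 0)
    (h : ∀ (v : V) (ψ : Module.Dual ℂ V), v ≠ 0 → ψ ≠ 0 → ∃ g, ψ (ρ g v) ≠ 0) :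
    ρ.IsIrreducible where
  exists_pair_ne := ⟨⊥, ⊤, fun hbt => hv₀ (by
    have h1 : v₀ ∈ (⊤ : Subrepresentation ρ).toSubmodule := trivial
    rw [← hbt] at h1
    exact (Submodule.mem_bot ℂ).1 h1)⟩
  eq_bot_or_eq_top U := by
    by_contra! hU
    obtain ⟨v, hvU, hv⟩ : ∃ v ∈ U.toSubmodule, v ≠ 0 := by
      by_contra! hv
      exact hU.1 (Subrepresentation.toSubmodule_injective ((Submodule.eq_bot_iff _).2 hv))
    have hlt : U.toSubmodule < ⊤ :=
      lt_top_iff_ne_top.2 fun h => hU.2 (Subrepresentation.toSubmodule_injective h)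
    obtain ⟨ψ, hψ, hψU⟩ := Submodule.exists_le_ker_of_lt_top _ hlt
    obtain ⟨g, hg⟩ := h v ψ hv hψ
    exact hg (hψU (U.apply_mem_toSubmodule g hvU))

theorem symMap_smul {n : ℕ} (c : ℂ) (M : Matrix (Fin n) (Fin n) ℂ) {d : ℕ} (p : Sym n d) :
    symMap (c • M) p = c ^ d • symMap M p := by
  refine Subtype.ext (MvPolynomial.ext _ _ fun m => ?_)
  have key : ∀ p : MvPolynomial (Fin n) ℂ, substMatrix (c • M) p =
      substMatrix M (substMatrix (Matrix.diagonal fun _ => c) p) := by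
    intro p
    have : substMatrix (c • M) =
        (substMatrix M).comp (substMatrix (Matrix.diagonal fun _ => c)) := by
      ext1 j
      simp [substMatrix_X, Matrix.diagonal_apply, ite_smul, Finset.smul_sum, smul_smul]
    rw [this]; rfl
  have key2 : substMatrix (Matrix.diagonal fun _ => c) p.1 = c ^ d • p.1 := by
    ext m
    rw [coeff_substMatrix_diagonal, MvPolynomial.coeff_smul, smul_eq_mul]
    by_cases hm : p.1.coeff m = 0
    · rw [hm, mul_zero, mul_zero]
    · rw [Finset.prod_pow_eq_pow_sum, Sym.sum_eq_of_coeff_ne_zero p hm]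
  rw [coe_symMap, key, key2, map_smul]
  rfl

/-- The `d`-th powers of linear forms span `Sym^d`. -/
theorem eq_zero_of_dual_linearForm_pow {n d : ℕ} (ψ : Module.Dual ℂ (Sym n d))
    (h : ∀ (a : Fin n → ℂ) (p : Sym n d),
      p.1 = (∑ i, a i • MvPolynomial.X i : MvPolynomial (Fin n) ℂ) ^ d → ψ p = 0) : ψ = 0 := by
  classical
  let S : Finset (Fin n →₀ ℕ) := Finset.finsuppAntidiag Finset.univ d
  have hS : ∀ m, m ∈ S ↔ ∑ i, m i = d := fun m => by simp [S, Finset.mem_finsuppAntidiag]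
  let e : (Fin n →₀ ℕ) → Sym n d := fun m => if hm : m ∈ S then
    ⟨MvPolynomial.monomial m 1, (MvPolynomial.mem_homogeneousSubmodule _ _).2
      (MvPolynomial.isHomogeneous_monomial 1 (by
        rw [Finsupp.degree_eq_sum]; exact (hS m).1 hm))⟩ else 0
  have he : ∀ p : Sym n d, p = ∑ m ∈ S, p.1.coeff m • e m := by
    intro p
    refine Subtype.ext ?_
    rw [Submodule.coe_sum]
    conv_lhs => rw [p.1.as_sum]
    rw [Finset.sum_subset (s₂ := S)]
    · refine Finset.sum_congr rfl fun m hm => ?_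
      simp [e, hm, MvPolynomial.smul_monomial]
    · intro m hm
      exact (hS m).2 (Sym.sum_eq_of_coeff_ne_zero p (by simpa using hm))
    · intro m _ hm
      simpa using hm
  -- By the multinomial theorem, `Q` at `a` is `ψ` of the `d`-th power of the linear form with
  -- coefficients `a`. It vanishes identically, and multinomial coefficients are nonzero in
  -- characteristic zero.
  let Q : MvPolynomial (Fin n) ℂ :=
    ∑ m ∈ S, MvPolynomial.monomial m ((m.multinomial : ℂ) * ψ (e m))
  have hQ : Q = 0 := by
    refine MvPolynomial.funext fun a => ?_
    have hmem : (∑ i, a i • MvPolynomial.X i : MvPolynomial (Fin n) ℂ) ^ d ∈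
        MvPolynomial.homogeneousSubmodule (Fin n) ℂ d := by
      have h1 : (∑ i, a i • MvPolynomial.X i : MvPolynomial (Fin n) ℂ).IsHomogeneous 1 :=
        MvPolynomial.IsHomogeneous.sum _ _ _ fun i _ =>
          (MvPolynomial.homogeneousSubmodule (Fin n) ℂ 1).smul_mem _
            (MvPolynomial.isHomogeneous_X ℂ i)
      have := h1.pow d
      rwa [one_mul] at this
    have h0 := h a ⟨_, hmem⟩ rfl
    rw [he ⟨_, hmem⟩, map_sum] at h0
    rw [map_zero, ← h0, map_sum]
    refine Finset.sum_congr rfl fun m hm => ?_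
    rw [map_smul, MvPolynomial.coeff_linearCombination_X_pow_of_fintype, if_pos,
      MvPolynomial.eval_monomial, smul_eq_mul]
    · ring
    · rw [Finsupp.sum_fintype _ _ (by simp)]
      exact (hS m).1 hm
  have hψ : ∀ m ∈ S, ψ (e m) = 0 := by
    intro m hm
    have h1 : Q.coeff m = 0 := by rw [hQ]; simp
    rw [MvPolynomial.coeff_sum, Finset.sum_eq_single m] at h1
    · rw [MvPolynomial.coeff_monomial, if_pos rfl] at h1
      refine (mul_eq_zero.1 h1).resolve_left ?_
      refine Nat.cast_ne_zero.2 ?_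
      rw [Finsupp.multinomial_eq]
      exact (Nat.multinomial_pos _ _).ne'
    · intro m' _ hm'
      rw [MvPolynomial.coeff_monomial, if_neg hm']
    · exact fun h => (h hm).elim
  ext p
  rw [he p, map_sum]
  exact Finset.sum_eq_zero fun m hm => by rw [map_smul, hψ m hm, smul_zero]

/-- A matrix coefficient vanishing on `SL(n, ℂ)` vanishes on invertible matrices by scaling and then
on all matrices by density. On the rank one matrix `a bᵀ` it is `p(b)` times `ψ` of a power of a
linear form, and such powers span. -/
theorem exists_dual_symRep_ne_zero {n d : ℕ} (hn : 0 < n) (p : Sym n d)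
    (ψ : Module.Dual ℂ (Sym n d)) (hp : p ≠ 0) (hψ : ψ ≠ 0) : ∃ g, ψ (symRep n d g p) ≠ 0 := by
  by_contra! hg
  have hdet : ∀ M : Matrix (Fin n) (Fin n) ℂ, M.det ≠ 0 → ψ (symMap M p) = 0 := by
    intro M hM
    obtain ⟨c, hc⟩ := IsAlgClosed.exists_pow_nat_eq M.det⁻¹ hn
    have hc0 : c ≠ 0 := by
      rintro rfl
      rw [zero_pow hn.ne'] at hc
      exact inv_ne_zero hM hc.symm
    have h1 := hg ⟨c • M, by rw [Matrix.det_smul, Fintype.card_fin, hc, inv_mul_cancel₀ hM]⟩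
    change ψ (symMap (c • M) p) = 0 at h1
    rw [symMap_smul, map_smul, smul_eq_mul] at h1
    exact (mul_eq_zero.1 h1).resolve_left (pow_ne_zero _ hc0)
  obtain ⟨P, hP⟩ := exists_eval_eq_dual_symMap ψ p
  have hP0 : P = 0 := by
    -- Density of invertible matrices: `P` times the determinant vanishes everywhere, and the
    -- determinant is a nonzero polynomial.
    have h1 : P * (Matrix.mvPolynomialX (Fin n) (Fin n) ℂ).det = 0 := by
      refine MvPolynomial.funext fun x => ?_
      have h2 : MvPolynomial.eval x (Matrix.mvPolynomialX (Fin n) (Fin n) ℂ).det =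
          (Matrix.of fun i j => x (i, j)).det := by
        rw [RingHom.map_det]
        congr 1
        ext i j; simp
      rw [map_mul, h2, map_zero]
      by_cases hx : (Matrix.of fun i j => x (i, j)).det = 0
      · rw [hx, mul_zero]
      · have := hdet _ hx
        rw [hP] at this
        rw [show MvPolynomial.eval x P = 0 from this, zero_mul]
    exact (mul_eq_zero.1 h1).resolve_right (Matrix.det_mvPolynomialX_ne_zero (Fin n) ℂ)
  have hall : ∀ M, ψ (symMap M p) = 0 := fun M => by rw [hP, hP0, map_zero]
  obtain ⟨b, hb⟩ : ∃ b, MvPolynomial.eval b p.1 ≠ 0 := by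
    by_contra! hb
    exact hp (Subtype.ext (MvPolynomial.funext fun b => by rw [hb b]; simp))
  refine hψ (eq_zero_of_dual_linearForm_pow ψ fun a q hq => ?_)
  have key : symMap (Matrix.of fun i j => a i * b j) p = MvPolynomial.eval b p.1 • q := by
    refine Subtype.ext ?_
    rw [coe_symMap, Submodule.coe_smul, hq]
    conv_lhs => rw [p.1.as_sum]
    rw [map_sum, MvPolynomial.eval_eq, Finset.sum_smul]
    refine Finset.sum_congr rfl fun m hm => ?_
    have hsum := Sym.sum_eq_of_coeff_ne_zero p (MvPolynomial.mem_support_iff.1 hm)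
    rw [substMatrix, MvPolynomial.aeval_monomial, Finsupp.prod_fintype _ _ (by simp)]
    have : ∀ j, (∑ i, (Matrix.of fun i j => a i * b j : Matrix (Fin n) (Fin n) ℂ) i j •
        MvPolynomial.X i : MvPolynomial (Fin n) ℂ) =
        MvPolynomial.C (b j) * ∑ i, a i • MvPolynomial.X i := by
      intro j
      rw [← MvPolynomial.smul_eq_C_mul, Finset.smul_sum]
      simp [smul_smul, mul_comm]
    simp only [this, mul_pow, Finset.prod_mul_distrib]
    rw [Finset.prod_pow_eq_pow_sum, hsum, Finset.prod_subset (Finset.subset_univ m.support),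
      MvPolynomial.smul_eq_C_mul, MvPolynomial.algebraMap_eq]
    · simp [mul_assoc]
    · intro i _ hi
      rw [Finsupp.notMem_support_iff.1 hi, pow_zero]
  have := hall (Matrix.of fun i j => a i * b j)
  rw [key, map_smul, smul_eq_mul] at this
  exact (mul_eq_zero.1 this).resolve_left hb

theorem X_pow_mem {n : ℕ} (i : Fin n) (d : ℕ) :
    (MvPolynomial.X i ^ d : MvPolynomial (Fin n) ℂ) ∈
      MvPolynomial.homogeneousSubmodule (Fin n) ℂ d :=
  MvPolynomial.isHomogeneous_X_pow i d

theorem isIrreducible_symRep {n : ℕ} (hn : 0 < n) (d : ℕ) : (symRep n d).IsIrreducible :=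
  isIrreducible_of_dual _ (v₀ := ⟨_, X_pow_mem ⟨0, hn⟩ d⟩)
    (fun h => pow_ne_zero d (MvPolynomial.X_ne_zero (R := ℂ) (⟨0, hn⟩ : Fin n))
      (congrArg Subtype.val h))
    (exists_dual_symRep_ne_zero hn)

/-- The representation of `SL(n, ℂ)` on the `d`-th symmetric power of the dual of `ℂ^n`. -/
def dualSymRep (n d : ℕ) : Representation ℂ SL(n, ℂ) (Sym n d) :=
  MonoidHom.comp (symRep n d) (contragredient n)

theorem dualSymRep_apply {n d : ℕ} (g : SL(n, ℂ)) (p : Sym n d) :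
    dualSymRep n d g p = symMap (g : Matrix (Fin n) (Fin n) ℂ).adjugate.transpose p := by
  rw [← coe_contragredient]
  rfl

theorem isIrreducible_dualSymRep {n : ℕ} (hn : 0 < n) (d : ℕ) : (dualSymRep n d).IsIrreducible :=
  isIrreducible_of_dual _ (v₀ := ⟨_, X_pow_mem ⟨0, hn⟩ d⟩)
    (fun h => pow_ne_zero d (MvPolynomial.X_ne_zero (R := ℂ) (⟨0, hn⟩ : Fin n))
      (congrArg Subtype.val h))
    (fun p ψ hp hψ => by
      obtain ⟨g, hg⟩ := exists_dual_symRep_ne_zero hn p ψ hp hψ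
      refine ⟨contragredient n g, ?_⟩
      change ψ (symRep n d (contragredient n (contragredient n g)) p) ≠ 0
      rwa [contragredient_contragredient])

/-! ### Support functions of products -/

/-- The support function of the Newton polytope of a product is at least the sum of the support
functions of the factors. -/
theorem exists_coeff_mul_ne_zero {n : ℕ} (l : Fin n → ℝ) {p q : MvPolynomial (Fin n) ℂ}
    {a b : Fin n →₀ ℕ} (ha : p.coeff a ≠ 0) (hb : q.coeff b ≠ 0) :
    ∃ m, (p * q).coeff m ≠ 0 ∧ ∑ k, l k * a k + ∑ k, l k * b k ≤ ∑ k, l k * m k := by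
  classical
  -- Ties in `l` are broken lexicographically. This gives a total order compatible with addition, so
  -- the product of the two leading monomials cannot cancel.
  let D : (Fin n →₀ ℕ) → ℝ ×ₗ Lex (Fin n →₀ ℕ) := fun m => toLex (∑ k, l k * m k, toLex m)
  have hadd : ∀ x y, D (x + y) = D x + D y := by
    intro x y
    have : ∑ k, l k * ((x + y) k : ℕ) = ∑ k, l k * x k + ∑ k, l k * y k := by
      simp [mul_add, Finset.sum_add_distrib]
    simp only [D, this]
    rfl
  have hinj : Function.Injective D := fun x y h => 
    congrArg (fun z : ℝ ×ₗ Lex (Fin n →₀ ℕ) => ofLex (ofLex z).2) h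
  have hfst : ∀ x y, D x ≤ D y → ∑ k, l k * x k ≤ ∑ k, l k * y k := by
    intro x y h
    rcases (Prod.Lex.le_iff).1 h with h | h
    · exact h.le
    · exact h.1.le
  obtain ⟨x, hx, hxmax⟩ := p.support.exists_max_image D ⟨a, MvPolynomial.mem_support_iff.2 ha⟩
  obtain ⟨y, hy, hymax⟩ := q.support.exists_max_image D ⟨b, MvPolynomial.mem_support_iff.2 hb⟩
  refine ⟨x + y, ?_, ?_⟩
  · rw [MvPolynomial.coeff_mul, Finset.sum_eq_single (x, y)]
    · exact mul_ne_zero (MvPolynomial.mem_support_iff.1 hx) (MvPolynomial.mem_support_iff.1 hy)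
    · rintro ⟨x', y'⟩ hxy hne
      by_contra h0
      have hx' := hxmax x' (MvPolynomial.mem_support_iff.2 (left_ne_zero_of_mul h0))
      have hy' := hymax y' (MvPolynomial.mem_support_iff.2 (right_ne_zero_of_mul h0))
      rw [Finset.HasAntidiagonal.mem_antidiagonal] at hxy
      have h1 : D x' + D y' = D x + D y := by rw [← hadd, ← hadd, hxy]
      obtain ⟨h2, h3⟩ := (add_eq_add_iff_eq_and_eq hx' hy').1 h1
      exact hne (Prod.ext (hinj h2) (hinj h3))
    · intro h
      exact (h (Finset.HasAntidiagonal.mem_antidiagonal.2 rfl)).elim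
  · have h1 := hfst _ _ (hxmax a (MvPolynomial.mem_support_iff.2 ha))
    have h2 := hfst _ _ (hymax b (MvPolynomial.mem_support_iff.2 hb))
    have : ∑ k, l k * ((x + y) k : ℕ) = ∑ k, l k * x k + ∑ k, l k * y k := by
      simp [mul_add, Finset.sum_add_distrib]
    rw [this]
    exact add_le_add h1 h2

theorem coeff_linearForm_mul_linearForm {n : ℕ} (x y : Fin n → ℂ) (i j : Fin n) :
    ((∑ k, x k • MvPolynomial.X k) * (∑ k, y k • MvPolynomial.X k) : MvPolynomial (Fin n) ℂ).coeff
      (Finsupp.single i 1 + Finsupp.single j 1) =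
        if i = j then x i * y i else x i * y j + x j * y i := by
  classical
  have h1 : ((∑ k, x k • MvPolynomial.X k) * (∑ k, y k • MvPolynomial.X k) :
      MvPolynomial (Fin n) ℂ) = ∑ k, ∑ k', MvPolynomial.monomial
        (Finsupp.single k 1 + Finsupp.single k' 1) (x k * y k') := by
    rw [Finset.sum_mul_sum]
    refine Finset.sum_congr rfl fun k _ => Finset.sum_congr rfl fun k' _ => ?_
    simp [MvPolynomial.X, MvPolynomial.smul_monomial, MvPolynomial.monomial_mul]
  have h2 : ∀ k k' : Fin n, (Finsupp.single k 1 + Finsupp.single k' 1 =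
      Finsupp.single i 1 + Finsupp.single j 1) ↔ (k = i ∧ k' = j) ∨ (k = j ∧ k' = i) := by
    intro k k'
    rw [Finsupp.single_add_single_eq_single_add_single one_ne_zero one_ne_zero]
    grind
  rw [h1]
  simp only [MvPolynomial.coeff_sum, MvPolynomial.coeff_monomial, h2]
  split_ifs with hij
  · subst hij
    rw [Finset.sum_eq_single i, Finset.sum_eq_single i] <;> simp +contextual
  · have h3 : ∀ k k' : Fin n, (if (k = i ∧ k' = j) ∨ (k = j ∧ k' = i) then x k * y k' else 0) =
        (if k = i ∧ k' = j then x k * y k' else 0) +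
          (if k = j ∧ k' = i then x k * y k' else 0) := by
      intro k k'
      by_cases ha : k = i ∧ k' = j
      · simp only [ha, and_self, hij, false_and, or_false, if_true, if_false, add_zero]
      · simp [ha]
    simp only [h3, Finset.sum_add_distrib]
    congr 1
    · rw [Finset.sum_eq_single i, Finset.sum_eq_single j] <;> simp +contextual
    · rw [Finset.sum_eq_single j, Finset.sum_eq_single i] <;> simp +contextual


/-! ### A homogeneous pair of irreducible representations of `SL(3, ℂ)` -/

/-- The conic `e₁ e₃ - e₂² + ε e₃²`. -/
def conic (ε : ℂ) : MvPolynomial (Fin 3) ℂ :=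
  MvPolynomial.X 0 * MvPolynomial.X 2 - MvPolynomial.X 1 * MvPolynomial.X 1 +
    MvPolynomial.C ε * (MvPolynomial.X 2 * MvPolynomial.X 2)

theorem isHomogeneous_conic (ε : ℂ) : (conic ε).IsHomogeneous 2 := by
  have hX : ∀ i j : Fin 3,
      (MvPolynomial.X i * MvPolynomial.X j : MvPolynomial (Fin 3) ℂ).IsHomogeneous 2 :=
    fun i j => (MvPolynomial.isHomogeneous_X ℂ i).mul (MvPolynomial.isHomogeneous_X ℂ j)
  refine ((hX 0 2).sub (hX 1 1)).add ?_
  have := (MvPolynomial.isHomogeneous_C (Fin 3) ε).mul (hX 2 2)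
  rwa [zero_add] at this

/-- The product of the conics `e₁ e₃ - e₂² ± e₃²`, which meet in a single point. -/
def conicPair : Sym 3 4 :=
  ⟨conic 1 * conic (-1), (isHomogeneous_conic 1).mul (isHomogeneous_conic (-1))⟩

/-- The product of the first and the third vector of the dual basis. -/
def dualPair : Sym 3 2 :=
  ⟨MvPolynomial.X 0 * MvPolynomial.X 2,
    (MvPolynomial.isHomogeneous_X ℂ 0).mul (MvPolynomial.isHomogeneous_X ℂ 2)⟩

theorem conic_ne_zero (ε : ℂ) : conic ε ≠ 0 := by
  intro h
  have := congrArg (MvPolynomial.eval ![0, 1, 0]) h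
  simp [conic] at this

theorem conicPair_ne_zero : conicPair ≠ 0 := fun h =>
  mul_ne_zero (conic_ne_zero 1) (conic_ne_zero (-1)) (congrArg Subtype.val h)

theorem dualPair_ne_zero : dualPair ≠ 0 := fun h =>
  mul_ne_zero (MvPolynomial.X_ne_zero (R := ℂ) (0 : Fin 3))
    (MvPolynomial.X_ne_zero (R := ℂ) (2 : Fin 3)) (congrArg Subtype.val h)

/-- The quadratic form of the conic on row vectors. -/
def conicForm (ε : ℂ) (x : Fin 3 → ℂ) : ℂ := x 0 * x 2 - x 1 ^ 2 + ε * x 2 ^ 2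

/-- The polar form of the conic on row vectors. -/
def conicPolar (ε : ℂ) (x y : Fin 3 → ℂ) : ℂ :=
  x 0 * y 2 + y 0 * x 2 - 2 * (x 1 * y 1) + 2 * ε * (x 2 * y 2)

theorem coeff_substMatrix_conic (ε : ℂ) (M : Matrix (Fin 3) (Fin 3) ℂ) (i j : Fin 3) :
    (substMatrix M (conic ε)).coeff (Finsupp.single i 1 + Finsupp.single j 1) =
      if i = j then conicForm ε (M i) else conicPolar ε (M i) (M j) := by
  simp only [conic, map_add, map_sub, map_mul, substMatrix_X, MvPolynomial.coeff_add,
    MvPolynomial.coeff_sub, coeff_linearForm_mul_linearForm, MvPolynomial.coeff_C_mul,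
    MvPolynomial.algHom_C, MvPolynomial.algebraMap_eq, conicForm, conicPolar]
  split_ifs <;> ring

/-- Half the Gram determinant of the polar form on three rows; for the standard basis it equals `1`
whatever `ε` is, whence the square of the determinant. -/
theorem conic_discriminant (ε : ℂ) (M : Matrix (Fin 3) (Fin 3) ℂ) (i j k : Fin 3) :
    (Matrix.of ![M i, M j, M k]).det ^ 2 =
      4 * conicForm ε (M i) * conicForm ε (M j) * conicForm ε (M k) +
        conicPolar ε (M i) (M j) * conicPolar ε (M j) (M k) * conicPolar ε (M i) (M k) -
        conicForm ε (M i) * conicPolar ε (M j) (M k) ^ 2 -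
        conicForm ε (M j) * conicPolar ε (M i) (M k) ^ 2 -
        conicForm ε (M k) * conicPolar ε (M i) (M j) ^ 2 := by
  rw [Matrix.det_fin_three]
  simp [conicForm, conicPolar]
  ring

theorem hasHighestWeight_symRep : HasHighestWeight (symRep 3 4) ![4, 0, 0] := by
  refine ⟨by decide, ⟨1, rfl⟩, ⟨_, X_pow_mem 0 4⟩, fun h => pow_ne_zero 4
    (MvPolynomial.X_ne_zero (R := ℂ) (0 : Fin 3)) (congrArg Subtype.val h), fun g hg => ?_⟩
  refine Subtype.ext ?_
  rw [symRep_eq_symMap, coe_symMap, Submodule.coe_smul, map_pow, substMatrix_X]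
  simp [Fin.sum_univ_three, Fin.prod_univ_three, hg 1 0 (by decide), hg 2 0 (by decide), smul_pow]

/-- An upper triangular `g` scales `e₃*` by `(g 2 2)⁻¹ = g 0 0 * g 1 1`. -/
theorem hasHighestWeight_dualSymRep : HasHighestWeight (dualSymRep 3 2) ![2, 2, 0] := by
  refine ⟨by decide, ⟨2, rfl⟩, ⟨_, X_pow_mem 2 2⟩, fun h => pow_ne_zero 2
    (MvPolynomial.X_ne_zero (R := ℂ) (2 : Fin 3)) (congrArg Subtype.val h), fun g hg => ?_⟩
  refine Subtype.ext ?_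
  rw [dualSymRep_apply, coe_symMap, Submodule.coe_smul, map_pow, substMatrix_X]
  simp [Fin.sum_univ_three, Fin.prod_univ_three, Matrix.adjugate_fin_three, hg 1 0 (by decide),
    hg 2 0 (by decide), hg 2 1 (by decide), smul_pow, mul_pow]

theorem homogeneous_dualSymRep_symRep : Homogeneous (dualSymRep 3 2) (symRep 3 4) :=
  ⟨_, _, hasHighestWeight_dualSymRep, hasHighestWeight_symRep, by simp [Fin.sum_univ_three]⟩

theorem isWeightCoord_dualSymRep (n d : ℕ) (c : ℤ) :
    IsWeightCoord (dualSymRep n d) (symCoord n d) (fun m j => -(m j : ℤ) + c) :=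
  (isWeightCoord_symRep n d).comp_contragredient.add_const c

theorem isRational_dualSymRep (n d : ℕ) : IsRational (dualSymRep n d) :=
  (isRational_symRep n d).comp_contragredient

/-- Coefficients of the translated conic are values of its quadratic and polar forms on the rows of
`M`. If the coefficients of `e_i²` and `e_i e_j` vanish, the discriminant forces those of `e_j²` and
`e_i e_k` to be nonzero; hence the unconditional bound `2 * l j`. -/
theorem exists_coeff_conic_ne_zero (l : Fin 3 → ℝ) {i j k : Fin 3} (hij : i ≠ j) (hik : i ≠ k)
    (hljl : l j ≤ l i) {M : Matrix (Fin 3) (Fin 3) ℂ}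
    (hM : (Matrix.of ![M i, M j, M k]).det ≠ 0) (ε : ℂ) :
    (conicForm ε (M i) ≠ 0 →
      ∃ m, (substMatrix M (conic ε)).coeff m ≠ 0 ∧ 2 * l i ≤ ∑ s, l s * m s) ∧
    (conicPolar ε (M i) (M j) ≠ 0 →
      ∃ m, (substMatrix M (conic ε)).coeff m ≠ 0 ∧ l i + l j ≤ ∑ s, l s * m s) ∧
    (∃ m, (substMatrix M (conic ε)).coeff m ≠ 0 ∧ 2 * l j ≤ ∑ s, l s * m s) ∧
    (conicForm ε (M i) = 0 → conicPolar ε (M i) (M j) = 0 →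
      ∃ m, (substMatrix M (conic ε)).coeff m ≠ 0 ∧ l i + l k ≤ ∑ s, l s * m s) := by
  have hsum : ∀ a b : Fin 3,
      ∑ s, l s * ((Finsupp.single a 1 + Finsupp.single b 1 : Fin 3 →₀ ℕ) s : ℕ) = l a + l b := by
    intro a b
    simp [mul_add, Finset.sum_add_distrib, Finsupp.single_apply]
  have hform : ∀ a, conicForm ε (M a) ≠ 0 →
      ∃ m, (substMatrix M (conic ε)).coeff m ≠ 0 ∧ 2 * l a ≤ ∑ s, l s * m s := by
    intro a ha
    refine ⟨Finsupp.single a 1 + Finsupp.single a 1, ?_, ?_⟩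
    · rwa [coeff_substMatrix_conic, if_pos rfl]
    · rw [hsum, two_mul]
  have hpolar : ∀ a b, a ≠ b → conicPolar ε (M a) (M b) ≠ 0 →
      ∃ m, (substMatrix M (conic ε)).coeff m ≠ 0 ∧ l a + l b ≤ ∑ s, l s * m s := by
    intro a b hab h
    refine ⟨Finsupp.single a 1 + Finsupp.single b 1, ?_, ?_⟩
    · rwa [coeff_substMatrix_conic, if_neg hab]
    · rw [hsum]
  have hdisc : conicForm ε (M i) = 0 → conicPolar ε (M i) (M j) = 0 →
      conicForm ε (M j) ≠ 0 ∧ conicPolar ε (M i) (M k) ≠ 0 := by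
    intro h1 h2
    have h3 := conic_discriminant ε M i j k
    rw [h1, h2] at h3
    constructor
    · intro h4
      exact pow_ne_zero 2 hM (by rw [h3, h4]; ring)
    · intro h4
      exact pow_ne_zero 2 hM (by rw [h3, h4]; ring)
  refine ⟨hform i, hpolar i j hij, ?_, fun h1 h2 => hpolar i k hik (hdisc h1 h2).2⟩
  by_cases h1 : conicForm ε (M i) = 0
  · by_cases h2 : conicPolar ε (M i) (M j) = 0
    · exact hform j (hdisc h1 h2).1
    · obtain ⟨m, hm, hl⟩ := hpolar i j hij h2
      exact ⟨m, hm, by linarith⟩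
  · obtain ⟨m, hm, hl⟩ := hform i h1
    exact ⟨m, hm, by linarith⟩

/-- If both conics vanish at a row vector, then it is a multiple of the first vector of the
dual basis. -/
theorem row_eq_of_conicForm_eq_zero {x : Fin 3 → ℂ} (h1 : conicForm 1 x = 0)
    (h2 : conicForm (-1) x = 0) : x 1 = 0 ∧ x 2 = 0 := by
  simp only [conicForm] at h1 h2
  have h3 : x 2 = 0 := by
    have : x 2 ^ 2 = 0 := by linear_combination (h1 - h2) / 2
    exact pow_eq_zero_iff two_ne_zero |>.1 this
  refine ⟨?_, h3⟩
  have : x 1 ^ 2 = 0 := by rw [h3] at h1; linear_combination -h1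
  exact pow_eq_zero_iff two_ne_zero |>.1 this

theorem numericallySemistable_conicPair :
    NumericallySemistable (dualSymRep 3 2) (symRep 3 4) dualPair conicPair := by
  refine numericallySemistable_of_support (isRational_dualSymRep 3 2) (isRational_symRep 3 4)
    (isWeightCoord_dualSymRep 3 2 2) (isWeightCoord_symRep 3 4) ?_
  intro g l m hm
  -- After sorting, `i`, `j`, `k` will denote the indices of the largest, middle and smallest value
  -- of `l`.
  obtain ⟨τ, hkj, hji⟩ : ∃ τ : Equiv.Perm (Fin 3), l (τ 0) ≤ l (τ 1) ∧ l (τ 1) ≤ l (τ 2) :=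
    ⟨Tuple.sort l, Tuple.monotone_sort l (by decide), Tuple.monotone_sort l (by decide)⟩
  have hs : ∀ f : Fin 3 → ℝ, ∑ s, f s = f (τ 2) + f (τ 1) + f (τ 0) := by
    intro f
    rw [← Equiv.sum_comp τ, Fin.sum_univ_three]
    ring
  have hij : τ 2 ≠ τ 1 := fun h => by simpa using τ.injective h
  have hik : τ 2 ≠ τ 0 := fun h => by simpa using τ.injective h
  have hjk : τ 1 ≠ τ 0 := fun h => by simpa using τ.injective h
  have hdet : (Matrix.of ![g (τ 2), g (τ 1), g (τ 0)]).det ≠ 0 := by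
    have h1 : Matrix.of ![g (τ 2), g (τ 1), g (τ 0)] =
        (g : Matrix (Fin 3) (Fin 3) ℂ).submatrix (Equiv.swap 0 2 |>.trans τ) id := by
      ext a b
      fin_cases a <;> rfl
    rw [h1, Matrix.det_permute, g.2]
    simp
  generalize τ 2 = i at *
  generalize τ 1 = j at *
  generalize τ 0 = k at *
  rw [symCoord_apply] at hm
  have hdeg : (m i : ℝ) + m j + m k = 2 := by
    have := Sym.sum_eq_of_coeff_ne_zero _ hm
    rw [← hs (fun k => (m k : ℝ))]
    exact_mod_cast this
  have hmi : (0 : ℝ) ≤ m i := Nat.cast_nonneg _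
  have hmj : (0 : ℝ) ≤ m j := Nat.cast_nonneg _
  have hmk : (m k : ℝ) = 2 - m i - m j := by linarith
  -- A weight of `g v` has value at most `2 * (l i + l j)`, with equality possible only by avoiding
  -- `e_i*` and `e_j*` or through ties.
  have hV : ∑ s, l s * ((-(m s : ℤ) + 2 : ℤ) : ℝ) =
      2 * (l j + l i) - (l i - l k) * m i - (l j - l k) * m j := by
    rw [hs]; push_cast; rw [hmk]; ring
  obtain ⟨f1, p1, c1, d1⟩ := exists_coeff_conic_ne_zero l hij hik hji hdet 1
  obtain ⟨f2, p2, c2, d2⟩ := exists_coeff_conic_ne_zero l hij hik hji hdet (-1)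
  have hprod : ∀ x y : ℝ,
      (∃ m, (substMatrix g (conic 1)).coeff m ≠ 0 ∧ x ≤ ∑ s, l s * m s) →
      (∃ m, (substMatrix g (conic (-1))).coeff m ≠ 0 ∧ y ≤ ∑ s, l s * m s) →
      2 * (l j + l i) - (l i - l k) * m i - (l j - l k) * m j ≤ x + y →
      ∃ m', symCoord 3 4 m' (symRep 3 4 g conicPair) ≠ 0 ∧
        ∑ s, l s * ((-(m s : ℤ) + 2 : ℤ) : ℝ) ≤ ∑ s, l s * ((m' s : ℤ) : ℝ) := by
    rintro x y ⟨a, ha, hxa⟩ ⟨b, hb, hyb⟩ hxy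
    obtain ⟨m', hm', hle⟩ := exists_coeff_mul_ne_zero l ha hb
    refine ⟨m', ?_, ?_⟩
    · rw [symCoord_apply, symRep_eq_symMap, coe_symMap]
      simpa only [conicPair, map_mul] using hm'
    · rw [hV]
      simp only [Int.cast_natCast]
      linarith
  have h1 := mul_nonneg (sub_nonneg.2 (hkj.trans hji)) hmi
  have h2 := mul_nonneg (sub_nonneg.2 hkj) hmj
  -- If one conic contains `e_i²`, it contributes `2 * l i` and the other one `2 * l j`, which is
  -- enough.
  by_cases hf1 : conicForm 1 (g i) = 0
  swap
  · exact hprod _ _ (f1 hf1) c2 (by linarith)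
  by_cases hf2 : conicForm (-1) (g i) = 0
  swap
  · exact hprod _ _ c1 (f2 hf2) (by linarith)
  obtain ⟨hg1, hg2⟩ := row_eq_of_conicForm_eq_zero hf1 hf2
  -- Row `i` is now a multiple of `e₁*`, where both polar forms reduce to this product. If it is
  -- nonzero, each conic contributes `l i + l j`.
  by_cases hp : g i 0 * g j 2 = 0
  swap
  · have hp1 : conicPolar 1 (g i) (g j) ≠ 0 := by simpa [conicPolar, hg1, hg2] using hp
    have hp2 : conicPolar (-1) (g i) (g j) ≠ 0 := by simpa [conicPolar, hg1, hg2] using hp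
    exact hprod _ _ (p1 hp1) (p2 hp2) (by linarith)
  have hp2 : conicPolar (-1) (g i) (g j) = 0 := by
    simp only [conicPolar, hg1, hg2]; linear_combination hp
  have hg0 : g i 0 ≠ 0 := by
    intro hg0
    have h0 := g.2
    rw [Matrix.det_eq_zero_of_row_eq_zero i] at h0
    · exact zero_ne_one h0
    · intro s
      fin_cases s
      · exact hg0
      · exact hg1
      · exact hg2
  -- Row `i` being a multiple of `e₁*` means that `g` carries `e₁*` to a multiple of `e_i*`; hence
  -- every monomial of `g v` contains `e_i*`.
  have hadj : ∀ s, s ≠ i → (g : Matrix (Fin 3) (Fin 3) ℂ).adjugate 0 s = 0 := by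
    intro s hsi
    have h3 := congrFun (congrFun (Matrix.mul_adjugate (g : Matrix (Fin 3) (Fin 3) ℂ)) i) s
    rw [Matrix.mul_apply, Fin.sum_univ_three, hg1, hg2, g.2, one_smul,
      Matrix.one_apply_ne hsi.symm, zero_mul, zero_mul, add_zero, add_zero] at h3
    exact (mul_eq_zero.1 h3).resolve_left hg0
  have hmi1 : 1 ≤ m i := by
    by_contra hmi0
    have e : substMatrix (g : Matrix (Fin 3) (Fin 3) ℂ).adjugate.transpose
        (MvPolynomial.X 0) =
          MvPolynomial.C ((g : Matrix (Fin 3) (Fin 3) ℂ).adjugate 0 i) * MvPolynomial.X i := by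
      rw [substMatrix_X, Finset.sum_eq_single i]
      · rw [MvPolynomial.smul_eq_C_mul, Matrix.transpose_apply]
      · intro s _ hsi
        rw [Matrix.transpose_apply, hadj s hsi, zero_smul]
      · simp
    rw [dualSymRep_apply, coe_symMap] at hm
    simp only [dualPair, map_mul] at hm
    rw [e, mul_assoc, MvPolynomial.coeff_C_mul, MvPolynomial.coeff_X_mul',
      if_neg (by simpa using hmi0), mul_zero] at hm
    exact hm rfl
  have hmi1' : (1 : ℝ) ≤ m i := by exact_mod_cast hmi1
  have h4 := mul_nonneg (sub_nonneg.2 (hkj.trans hji)) (sub_nonneg.2 hmi1')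
  -- The factor `e_i*` lowers the value of `g v` to at most `l i + 2 * l j + l k`, met by `2 * l j`
  -- from one conic and `l i + l k` from the other.
  exact hprod _ _ c1 (d2 hf2 hp2) (by linarith)

/-- The elements `g` preserve `e₁e₃ - e₂²` and keep `g e₃ = e₁ + 2t e₂ + t² e₃` bounded, so `g w =
(e₁e₃ - e₂²)² - (g e₃)⁴` is bounded. But `g e₃* = t⁻² e₃*` and `g e₁* = t² e₁* - t e₂* + e₃*`, so
`t² g v` tends to `(e₃*)²`. -/
theorem not_semistable_conicPair :
    ¬ Semistable (dualSymRep 3 2) (symRep 3 4) dualPair conicPair := by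
  let t : ℕ → ℂ := fun k => 1 / ((k : ℂ) + 1)
  have ht : Filter.Tendsto t Filter.atTop (𝓝 0) := tendsto_one_div_add_atTop_nhds_zero_nat
  have ht0 : ∀ k, t k ≠ 0 := fun k => one_div_ne_zero (by exact_mod_cast Nat.succ_ne_zero k)
  let g : ℕ → SL(3, ℂ) := fun k =>
    ⟨!![(t k ^ 2)⁻¹, (t k)⁻¹, 1; 0, 1, 2 * t k; 0, 0, t k ^ 2], by
      simp [Matrix.det_fin_three, ht0 k]⟩
  -- The columns are `g e₁*` and `t² g e₃*`; the middle one is irrelevant because `e₂*` does not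
  -- occur in `v`. Likewise only the last column of `N`, namely `g e₃`, is used.
  let M : ℂ → Matrix (Fin 3) (Fin 3) ℂ := fun t => !![t ^ 2, 0, 0; -t, 0, 0; 1, 0, 1]
  let N : ℂ → Matrix (Fin 3) (Fin 3) ℂ := fun t => !![0, 0, 1; 0, 0, 2 * t; 0, 0, t ^ 2]
  have hM : Continuous M := by
    refine continuous_matrix fun i j => ?_
    fin_cases i <;> fin_cases j <;> simp [M] <;> fun_prop
  have hN : Continuous N := by
    refine continuous_matrix fun i j => ?_
    fin_cases i <;> fin_cases j <;> simp [N] <;> fun_prop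
  let c : Sym 3 4 := ⟨conic 0 * conic 0, (isHomogeneous_conic 0).mul (isHomogeneous_conic 0)⟩
  let x : Sym 3 4 := ⟨_, X_pow_mem 2 4⟩
  have hv : ∀ k, t k ^ 2 • dualSymRep 3 2 (g k) dualPair = symMap (M (t k)) dualPair := by
    intro k
    refine Subtype.ext ?_
    rw [Submodule.coe_smul, dualSymRep_apply, coe_symMap, coe_symMap]
    have hA : (g k : Matrix (Fin 3) (Fin 3) ℂ).adjugate.transpose =
        !![t k ^ 2, 0, 0; -t k, 1, 0; 1, -2 * (t k)⁻¹, (t k ^ 2)⁻¹] := by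
      have := ht0 k
      rw [Matrix.adjugate_fin_three]
      ext i j
      fin_cases i <;> fin_cases j <;> simp [g] <;> field_simp <;> ring
    have h0 : MvPolynomial.C (t k ^ 2) * MvPolynomial.C (t k ^ 2)⁻¹ =
        (1 : MvPolynomial (Fin 3) ℂ) := by
      rw [← MvPolynomial.C_mul, mul_inv_cancel₀ (pow_ne_zero 2 (ht0 k)), MvPolynomial.C_1]
    rw [hA]
    simp only [dualPair, map_mul, substMatrix_X, Fin.sum_univ_three, MvPolynomial.smul_eq_C_mul, M]
    simp only [Matrix.of_apply, Matrix.cons_val', Matrix.cons_val, map_zero, zero_mul, zero_add,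
      add_zero, map_one, one_mul]
    linear_combination (MvPolynomial.C (t k ^ 2) * MvPolynomial.X 0 +
      MvPolynomial.C (-t k) * MvPolynomial.X 1 + MvPolynomial.X 2) * MvPolynomial.X 2 * h0
  have hw : ∀ k, symRep 3 4 (g k) conicPair = c - symMap (N (t k)) x := by
    intro k
    refine Subtype.ext ?_
    have h0 : MvPolynomial.C (t k) * MvPolynomial.C (t k)⁻¹ =
        (1 : MvPolynomial (Fin 3) ℂ) := by
      rw [← MvPolynomial.C_mul, mul_inv_cancel₀ (ht0 k), MvPolynomial.C_1]
    have h2 : (MvPolynomial.C 2 : MvPolynomial (Fin 3) ℂ) = 2 := map_ofNat _ 2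
    have key : ∀ ε, substMatrix (g k : Matrix (Fin 3) (Fin 3) ℂ) (conic ε) = conic 0 +
        MvPolynomial.C ε * substMatrix (N (t k)) (MvPolynomial.X 2) ^ 2 := by
      intro ε
      simp only [conic, map_add, map_sub, map_mul, substMatrix_X, Fin.sum_univ_three,
        MvPolynomial.smul_eq_C_mul, MvPolynomial.algHom_C, MvPolynomial.algebraMap_eq, g, N]
      simp only [Matrix.of_apply, Matrix.cons_val', Matrix.cons_val, map_zero, zero_mul,
        add_zero, map_one, one_mul, map_mul, map_pow, ← inv_pow, h2]
      linear_combination (MvPolynomial.X 0 * MvPolynomial.X 2 *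
        (MvPolynomial.C (t k) * MvPolynomial.C (t k)⁻¹ + 1) +
        2 * MvPolynomial.C (t k)⁻¹ * MvPolynomial.X 0 * MvPolynomial.X 1) * h0
    have e1 : (conicPair : MvPolynomial (Fin 3) ℂ) = conic 1 * conic (-1) := rfl
    have e2 : (x : MvPolynomial (Fin 3) ℂ) = MvPolynomial.X 2 ^ 4 := rfl
    have e3 : (c : MvPolynomial (Fin 3) ℂ) = conic 0 * conic 0 := rfl
    rw [symRep_eq_symMap, Submodule.coe_sub, coe_symMap, coe_symMap, e1, e2, e3, map_mul, key, key,
      map_pow, map_one, map_neg, map_one]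
    ring
  refine not_semistable_of_tendsto (y := symMap (M 0) dualPair) ?_ Filter.atTop
    (fun k => Units.mk0 (t k ^ 2) (pow_ne_zero _ (ht0 k))) g (fun ψ => ?_) fun ψ => ?_
  · intro h
    have h' := congrArg Subtype.val h
    rw [coe_symMap] at h'
    simp [M, dualPair, substMatrix_X, Fin.sum_univ_three] at h'
  · simp only [Units.val_mk0, hv]
    exact (((continuous_dual_symMap ψ dualPair).comp hM).tendsto 0).comp ht
  · simp only [Units.val_mk0, hw, map_smul, map_sub]
    have h1 := (((continuous_dual_symMap ψ x).comp hN).tendsto 0).comp ht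
    have h2 := (ht.pow 2).smul ((tendsto_const_nhds (x := ψ c)).sub h1)
    rwa [zero_pow two_ne_zero, zero_smul] at h2


/-! ### The maximal tori of `SL(2, ℂ)` -/

/-- The diagonal matrix with entries `p`, `p⁻¹`. -/
def diagSL2 (p : ℂˣ) : SL(2, ℂ) := ⟨!![(p : ℂ), 0; 0, (p : ℂ)⁻¹], by simp [Matrix.det_fin_two]⟩

/-- The upper triangular unipotent matrix with entry `x`. -/
def upperSL2 (x : ℂ) : SL(2, ℂ) := ⟨!![1, x; 0, 1], by simp [Matrix.det_fin_two]⟩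

/-- The lower triangular unipotent matrix with entry `y`. -/
def lowerSL2 (y : ℂ) : SL(2, ℂ) := ⟨!![1, 0; y, 1], by simp [Matrix.det_fin_two]⟩

theorem coe_diagSL2 (p : ℂˣ) :
    (diagSL2 p : Matrix (Fin 2) (Fin 2) ℂ) = !![(p : ℂ), 0; 0, (p : ℂ)⁻¹] := rfl

theorem coe_upperSL2 (x : ℂ) : (upperSL2 x : Matrix (Fin 2) (Fin 2) ℂ) = !![1, x; 0, 1] := rfl

theorem coe_lowerSL2 (y : ℂ) : (lowerSL2 y : Matrix (Fin 2) (Fin 2) ℂ) = !![1, 0; y, 1] := rfl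

theorem diagSL2_mul_upperSL2 (p : ℂˣ) (x : ℂ) :
    upperSL2 ((p : ℂ) ^ 2 * x) = diagSL2 p * upperSL2 x * diagSL2 p⁻¹ := by
  refine Subtype.ext ?_
  simp only [Matrix.SpecialLinearGroup.coe_mul, coe_diagSL2, coe_upperSL2, Matrix.mul_fin_two]
  simp; ring

theorem diagSL2_mul_lowerSL2 (p : ℂˣ) (y : ℂ) :
    lowerSL2 ((p : ℂ) ^ 2 * y) = diagSL2 p⁻¹ * lowerSL2 y * diagSL2 p := by
  refine Subtype.ext ?_
  simp only [Matrix.SpecialLinearGroup.coe_mul, coe_diagSL2, coe_lowerSL2, Matrix.mul_fin_two]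
  simp; ring

theorem upperSL2_add (x y : ℂ) : upperSL2 (x + y) = upperSL2 x * upperSL2 y := by
  refine Subtype.ext ?_
  simp only [Matrix.SpecialLinearGroup.coe_mul, coe_upperSL2, Matrix.mul_fin_two]
  simp [add_comm]

theorem upperSL2_zero : upperSL2 0 = 1 := by
  refine Subtype.ext ?_
  rw [coe_upperSL2, Matrix.SpecialLinearGroup.coe_one, Matrix.one_fin_two]

theorem lowerSL2_zero : lowerSL2 0 = 1 := by
  refine Subtype.ext ?_
  rw [coe_lowerSL2, Matrix.SpecialLinearGroup.coe_one, Matrix.one_fin_two]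

/-- A matrix with nonzero upper left entry is a product of triangular matrices. -/
theorem eq_lowerSL2_mul_diagSL2_mul_upperSL2 (g : SL(2, ℂ)) (p : ℂˣ) (hp : g 0 0 = p) :
    g = lowerSL2 (g 1 0 / p) * diagSL2 p * upperSL2 (g 0 1 / p) := by
  have hdet := g.2
  rw [Matrix.det_fin_two, hp] at hdet
  have hp0 := p.ne_zero
  refine Subtype.ext ?_
  simp only [Matrix.SpecialLinearGroup.coe_mul, coe_diagSL2, coe_upperSL2, coe_lowerSL2,
    Matrix.mul_fin_two]
  rw [Matrix.eta_fin_two (g : Matrix (Fin 2) (Fin 2) ℂ)]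
  ext i j
  fin_cases i <;> fin_cases j
  · simp [hp]
  · simp [mul_div_cancel₀]
  · simp
  · simp
    field_simp
    linear_combination hdet

/-- The torus `g⁻¹ D g`, where `D` is the diagonal torus. -/
def conjTorus (g : SL(2, ℂ)) : (Fin 1 → ℂˣ) →* SL(2, ℂ) where
  toFun t := g⁻¹ * diagSL2 (t 0) * g
  map_one' := by
    have : diagSL2 1 = 1 := by
      refine Subtype.ext ?_
      rw [coe_diagSL2, Matrix.SpecialLinearGroup.coe_one, Matrix.one_fin_two]
      simp
    simp [this]
  map_mul' s t := by
    have : diagSL2 (s 0 * t 0) = diagSL2 (s 0) * diagSL2 (t 0) := by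
      refine Subtype.ext ?_
      simp only [Matrix.SpecialLinearGroup.coe_mul, coe_diagSL2, Matrix.mul_fin_two]
      simp [mul_comm]
    rw [Pi.mul_apply, this]
    group

theorem conjTorus_apply (g : SL(2, ℂ)) (t : Fin 1 → ℂˣ) :
    conjTorus g t = g⁻¹ * diagSL2 (t 0) * g := rfl

theorem torusChar_fin_one (m : Fin 1 → ℤ) (t : Fin 1 → ℂˣ) :
    torusChar m t = (t 0 : ℂ) ^ m 0 := by
  simp [torusChar]

theorem isTorusEmbedding_conjTorus (g : SL(2, ℂ)) : IsTorusEmbedding (conjTorus g) := by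
  constructor
  · intro s t h
    rw [conjTorus_apply, conjTorus_apply, mul_left_inj, mul_right_inj] at h
    have h1 := congrArg (fun x : SL(2, ℂ) => x 0 0) h
    funext i
    rw [Subsingleton.elim i 0]
    exact Units.ext h1
  · refine ⟨Finsupp.single (fun _ => 1) (((g⁻¹ : SL(2, ℂ)) : Matrix (Fin 2) (Fin 2) ℂ) * !![1, 0; 0, 0] *
      (g : Matrix (Fin 2) (Fin 2) ℂ)) +
      Finsupp.single (fun _ => -1) (((g⁻¹ : SL(2, ℂ)) : Matrix (Fin 2) (Fin 2) ℂ) * !![0, 0; 0, 1] *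
      (g : Matrix (Fin 2) (Fin 2) ℂ)), fun t => ?_⟩
    rw [Finsupp.sum_add_index' (by simp) (by simp [smul_add]), Finsupp.sum_single_index (by simp),
      Finsupp.sum_single_index (by simp), torusChar_fin_one, torusChar_fin_one, conjTorus_apply,
      Matrix.SpecialLinearGroup.coe_mul, Matrix.SpecialLinearGroup.coe_mul]
    have : (diagSL2 (t 0) : Matrix (Fin 2) (Fin 2) ℂ) =
        (t 0 : ℂ) ^ (1 : ℤ) • !![1, 0; 0, 0] + (t 0 : ℂ) ^ (-1 : ℤ) • !![0, 0; 0, 1] := by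
      rw [coe_diagSL2]
      ext i j
      fin_cases i <;> fin_cases j <;> simp
    rw [this, Matrix.mul_add, Matrix.add_mul, Matrix.mul_smul, Matrix.mul_smul, Matrix.smul_mul,
      Matrix.smul_mul]

/-- A larger torus is commutative, so it centralizes the conjugate of `diag(2, 1/2)`, whose
centralizer is already the conjugate of the diagonal torus. -/
theorem maximal_conjTorus (g : SL(2, ℂ)) : Maximal IsTorus (conjTorus g).range := by
  refine ⟨⟨1, conjTorus g, isTorusEmbedding_conjTorus g, rfl⟩, ?_⟩
  rintro _ ⟨r, φ, -, rfl⟩ hle _ ⟨s, rfl⟩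
  let two : Fin 1 → ℂˣ := fun _ => Units.mk0 2 two_ne_zero
  obtain ⟨s', hs'⟩ := hle ⟨two, rfl⟩
  have hcomm : φ s * conjTorus g two = conjTorus g two * φ s := by
    rw [← hs', ← map_mul, ← map_mul, mul_comm]
  set y : SL(2, ℂ) := g * φ s * g⁻¹ with hy
  have hy' : φ s = g⁻¹ * y * g := by rw [hy]; group
  have hcy : y * diagSL2 (two 0) = diagSL2 (two 0) * y := by
    rw [conjTorus_apply, hy'] at hcomm
    have : g * (g⁻¹ * y * g * (g⁻¹ * diagSL2 (two 0) * g)) * g⁻¹ =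
        g * (g⁻¹ * diagSL2 (two 0) * g * (g⁻¹ * y * g)) * g⁻¹ := by rw [hcomm]
    simpa [mul_assoc] using this
  have hm := congrArg (fun z : SL(2, ℂ) => (z : Matrix (Fin 2) (Fin 2) ℂ)) hcy
  simp only [Matrix.SpecialLinearGroup.coe_mul, coe_diagSL2] at hm
  have h01 := congrFun (congrFun hm 0) 1
  have h10 := congrFun (congrFun hm 1) 0
  simp only [Matrix.mul_apply, Fin.sum_univ_two, two, Units.val_mk0, Matrix.of_apply,
    Matrix.cons_val', Matrix.cons_val, mul_zero, zero_mul, zero_add, add_zero] at h01 h10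
  have h01' : y 0 1 = 0 := by linear_combination (-2 / 3 : ℂ) * h01
  have h10' : y 1 0 = 0 := by linear_combination (2 / 3 : ℂ) * h10
  have hdet := y.2
  rw [Matrix.det_fin_two, h01', zero_mul, sub_zero] at hdet
  have hy0 : y 0 0 ≠ 0 := left_ne_zero_of_mul (hdet.trans_ne one_ne_zero)
  refine ⟨fun _ => Units.mk0 (y 0 0) hy0, ?_⟩
  rw [conjTorus_apply, hy']
  congr 2
  refine Subtype.ext ?_
  rw [coe_diagSL2]
  ext i j
  fin_cases i <;> fin_cases j
  · simp
  · simpa using h01'.symm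
  · simpa using h10'.symm
  · simpa using inv_eq_of_mul_eq_one_right hdet

/-! ### Weight bases for `SL(2, ℂ)` -/

theorem IsRational.exists_weight_basis_SL2 {V : Type*} [AddCommGroup V] [Module ℂ V]
    {ρ : Representation ℂ SL(2, ℂ) V} (hρ : IsRational ρ) :
    ∃ (b : Module.Basis (Fin (Module.finrank ℂ V)) ℂ V) (wt : Fin (Module.finrank ℂ V) → ℤ),
      ∀ i p, ρ (diagSL2 p) (b i) = (p : ℂ) ^ wt i • b i := by
  obtain ⟨b, wt, h⟩ := hρ.exists_weight_basis (isTorusEmbedding_conjTorus 1)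
  refine ⟨b, fun i => wt i 0, fun i p => ?_⟩
  have := h i fun _ => p
  rwa [torusChar_fin_one, conjTorus_apply, inv_one, one_mul, mul_one] at this

/-- Every translate of `v` has no weights above the highest weight of the corresponding translate of
`w`. -/
def WeightDominated {V W ι κ : Type*} [AddCommGroup V] [Module ℂ V] [AddCommGroup W] [Module ℂ W]
    (ρ : Representation ℂ SL(2, ℂ) V) (σ : Representation ℂ SL(2, ℂ) W)
    (b : Module.Basis ι ℂ V) (wt : ι → ℤ) (c : Module.Basis κ ℂ W) (wt' : κ → ℤ)
    (v : V) (w : W) : Prop :=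
  ∀ g i, b.coord i (ρ g v) ≠ 0 → ∃ j, c.coord j (σ g w) ≠ 0 ∧ wt i ≤ wt' j

section

variable {V W ι κ : Type*} [AddCommGroup V] [Module ℂ V] [AddCommGroup W] [Module ℂ W]
  {ρ : Representation ℂ SL(2, ℂ) V} {σ : Representation ℂ SL(2, ℂ) W}
  {b : Module.Basis ι ℂ V} {wt : ι → ℤ} {c : Module.Basis κ ℂ W} {wt' : κ → ℤ}

theorem coord_diagSL2 (hb : ∀ i p, ρ (diagSL2 p) (b i) = (p : ℂ) ^ wt i • b i) (i : ι) (p : ℂˣ)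
    (x : V) : b.coord i (ρ (diagSL2 p) x) = (p : ℂ) ^ wt i * b.coord i x :=
  coord_weight b _ _ (fun i => hb i p) i x

theorem weightSupport_conjTorus (hρ : IsRational ρ)
    (hb : ∀ i p, ρ (diagSL2 p) (b i) = (p : ℂ) ^ wt i • b i) (g : SL(2, ℂ)) (v : V) :
    weightSupport (conjTorus g) ρ v = (fun i _ => wt i) '' {i | b.coord i (ρ g v) ≠ 0} := by
  refine weightSupport_eq hρ (isTorusEmbedding_conjTorus g) (fun i => b.coord i ∘ₗ ρ g) _
    (fun x hx => ?_) (fun i t x => ?_) v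
  · have h0 : ρ g x = 0 := b.ext_elem fun i => by simpa using hx i
    have := congrArg (ρ g⁻¹) h0
    rwa [map_zero, ← Module.End.mul_apply, ← map_mul, inv_mul_cancel, map_one] at this
  · rw [torusChar_fin_one, LinearMap.comp_apply, LinearMap.comp_apply, ← coord_diagSL2 hb,
      conjTorus_apply, ← Module.End.mul_apply, ← Module.End.mul_apply, ← map_mul, ← map_mul]
    congr 3
    group

/-- For `g⁻¹ D g` the polytopes are segments on a line and the weights of `v` are those of `g v`
under `D`. Only the upper ends are compared; the lower ends belong to other translates. -/
theorem NumericallySemistable.weightDominated (hρ : IsRational ρ) (hσ : IsRational σ)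
    (hb : ∀ i p, ρ (diagSL2 p) (b i) = (p : ℂ) ^ wt i • b i)
    (hc : ∀ i p, σ (diagSL2 p) (c i) = (p : ℂ) ^ wt' i • c i) {v : V} {w : W}
    (h : NumericallySemistable ρ σ v w) : WeightDominated ρ σ b wt c wt' v w := by
  intro g i hi
  have hsub := h 1 (conjTorus g) (isTorusEmbedding_conjTorus g) (maximal_conjTorus g)
  rw [weightPolytope, weightPolytope, weightSupport_conjTorus hρ hb,
    weightSupport_conjTorus hσ hc] at hsub
  by_contra! hlt
  have hmem := hsub (subset_convexHull ℝ _ ⟨_, ⟨i, hi, rfl⟩, rfl⟩)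
  have hhalf : convexHull ℝ ((fun (m : Fin 1 → ℤ) (i : Fin 1) => (m i : ℝ)) ''
      ((fun i _ => wt' i) '' {i | c.coord i (σ g w) ≠ 0})) ⊆
      {x : Fin 1 → ℝ | x 0 < wt i} := by
    refine convexHull_min ?_
      (convex_halfSpace_lt (LinearMap.proj (R := ℝ) (φ := fun _ : Fin 1 => ℝ) 0).isLinear _)
    rintro _ ⟨_, ⟨j, hj, rfl⟩, rfl⟩
    have : (wt' j : ℝ) < wt i := Int.cast_lt.2 (hlt j hj)
    exact this
  have : (wt i : ℝ) < wt i := hhalf hmem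
  exact lt_irrefl _ this

theorem WeightDominated.translate {v : V} {w : W} (h : WeightDominated ρ σ b wt c wt' v w)
    (k : SL(2, ℂ)) : WeightDominated ρ σ b wt c wt' (ρ k v) (σ k w) := by
  intro g i hi
  have := h (g * k) i (by rwa [map_mul])
  simpa only [map_mul, Module.End.mul_apply] using this

/-! ### Coordinates along unipotent one-parameter subgroups. -/

/-- Matrix coefficients are polynomial along polynomial curves in `SL(2, ℂ)`. -/
theorem IsRational.exists_polynomial (hρ : IsRational ρ) (φ : Module.Dual ℂ V) (v : V)
    (N : Matrix (Fin 2) (Fin 2) (Polynomial ℂ)) :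
    ∃ P : Polynomial ℂ, ∀ (x : ℂ) (g : SL(2, ℂ)), (∀ i j, g i j = (N i j).eval x) →
      φ (ρ g v) = P.eval x := by
  obtain ⟨p, hp⟩ := hρ.2 φ v
  refine ⟨MvPolynomial.aeval (fun ij : Fin 2 × Fin 2 => N ij.1 ij.2) p, fun x g hg => ?_⟩
  rw [hp, ← Polynomial.coe_evalRingHom, MvPolynomial.aeval_def, MvPolynomial.hom_eval₂]
  rw [MvPolynomial.eval, MvPolynomial.coe_eval₂Hom]
  congr 1
  · ext; simp
  · funext ij
    simp [hg]

/-- Comparing coefficients gives `4 ^ k = 2 ^ e`. The numbers come from conjugation by `diag(2,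
1/2)`, which multiplies a unipotent parameter by `4` and a coordinate by a power of `2`. -/
theorem coeff_of_eval_four_mul (P : Polynomial ℂ) (e : ℤ)
    (h : ∀ x, P.eval (4 * x) = 2 ^ e * P.eval x) (k : ℕ) (hk : P.coeff k ≠ 0) : 2 * (k : ℤ) = e := by
  have h1 : P.comp (Polynomial.C 4 * Polynomial.X) = Polynomial.C ((2 : ℂ) ^ e) * P := by
    refine Polynomial.funext fun x => ?_
    simp [h]
  have h2 := congrArg (fun Q => Polynomial.coeff Q k) h1
  simp only [Polynomial.comp_C_mul_X_coeff, Polynomial.coeff_C_mul] at h2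
  rw [mul_comm] at h2
  have h3 := mul_right_cancel₀ hk h2
  refine two_zpow_injective ?_
  rw [← h3, zpow_mul]
  norm_num

theorem exists_polynomial_upperSL2_basis (hρ : IsRational ρ)
    (hb : ∀ i p, ρ (diagSL2 p) (b i) = (p : ℂ) ^ wt i • b i) (i j : ι) :
    ∃ P : Polynomial ℂ, (∀ x, b.coord i (ρ (upperSL2 x) (b j)) = P.eval x) ∧
      ∀ k, P.coeff k ≠ 0 → wt i = wt j + 2 * k := by
  obtain ⟨P, hP⟩ := hρ.exists_polynomial (b.coord i) (b j) !![1, Polynomial.X; 0, 1]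
  have hP' : ∀ x, b.coord i (ρ (upperSL2 x) (b j)) = P.eval x := fun x => hP x _ (by
    intro i j; fin_cases i <;> fin_cases j <;> simp [coe_upperSL2])
  refine ⟨P, hP', fun k hk => ?_⟩
  have := coeff_of_eval_four_mul P (wt i - wt j) (fun x => ?_) k hk
  · linarith
  · have h2 := diagSL2_mul_upperSL2 (Units.mk0 2 two_ne_zero) x
    rw [Units.val_mk0, show (2 : ℂ) ^ 2 = 4 by norm_num] at h2
    rw [← hP', h2, map_mul, map_mul, Module.End.mul_apply, Module.End.mul_apply, hb, map_smul,
      map_smul, map_smul, coord_diagSL2 hb, hP', smul_eq_mul, zpow_sub₀ two_ne_zero]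
    simp
    field_simp

/-- Lower unipotents only move weights downwards, so nothing can be added to a coordinate of maximal
weight. -/
theorem coord_lowerSL2_of_maximal (hρ : IsRational ρ)
    (hb : ∀ i p, ρ (diagSL2 p) (b i) = (p : ℂ) ^ wt i • b i) (i : ι) (hi : ∀ j, wt j ≤ wt i)
    (y : ℂ) (x : V) : b.coord i (ρ (lowerSL2 y) x) = b.coord i x := by
  suffices b.coord i ∘ₗ ρ (lowerSL2 y) = b.coord i from LinearMap.congr_fun this x
  refine b.ext fun j => ?_
  obtain ⟨P, hP⟩ := hρ.exists_polynomial (b.coord i) (b j) !![1, 0; Polynomial.X, 1]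
  have hP' : ∀ x, b.coord i (ρ (lowerSL2 x) (b j)) = P.eval x := fun x => hP x _ (by
    intro i j; fin_cases i <;> fin_cases j <;> simp [coe_lowerSL2])
  have hcoeff : ∀ k, P.coeff k ≠ 0 → k = 0 := by
    intro k hk
    have := coeff_of_eval_four_mul P (wt j - wt i) (fun x => ?_) k hk
    · have := hi j
      omega
    · have h2 := diagSL2_mul_lowerSL2 (Units.mk0 2 two_ne_zero) x
      rw [Units.val_mk0, show (2 : ℂ) ^ 2 = 4 by norm_num] at h2
      rw [← hP', h2, map_mul, map_mul, Module.End.mul_apply, Module.End.mul_apply, hb, map_smul,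
        map_smul, map_smul, coord_diagSL2 hb, hP', smul_eq_mul, zpow_sub₀ two_ne_zero]
      simp
      field_simp
  have hPC : P = Polynomial.C (P.coeff 0) := by
    ext k
    rw [Polynomial.coeff_C]
    split_ifs with h
    · rw [h]
    · by_contra h0
      exact h (hcoeff k h0)
  have h0 := hP' 0
  rw [lowerSL2_zero, map_one, Module.End.one_apply] at h0
  rw [LinearMap.comp_apply, hP', h0, hPC]
  simp

theorem exists_polynomial_upperSL2 [Fintype ι] (hρ : IsRational ρ)
    (hb : ∀ i p, ρ (diagSL2 p) (b i) = (p : ℂ) ^ wt i • b i) (i : ι) (v : V) :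
    ∃ P : Polynomial ℂ, (∀ x, b.coord i (ρ (upperSL2 x) v) = P.eval x) ∧
      ∀ k, P.coeff k ≠ 0 → ∃ j, b.coord j v ≠ 0 ∧ wt i = wt j + 2 * k := by
  choose P hP hPk using exists_polynomial_upperSL2_basis hρ hb i
  refine ⟨∑ j, Polynomial.C (b.coord j v) * P j, fun x => ?_, fun k hk => ?_⟩
  · conv_lhs => rw [← b.sum_repr v]
    rw [map_sum, map_sum, Polynomial.eval_finsetSum]
    refine Finset.sum_congr rfl fun j _ => ?_
    rw [map_smul, map_smul, Polynomial.eval_mul, Polynomial.eval_C, ← hP, smul_eq_mul]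
    rfl
  · rw [Polynomial.finsetSum_coeff] at hk
    obtain ⟨j, -, hj⟩ := Finset.exists_ne_zero_of_sum_ne_zero hk
    rw [Polynomial.coeff_C_mul] at hj
    exact ⟨j, left_ne_zero_of_mul hj, hPk j k (right_ne_zero_of_mul hj)⟩

/-- In an irreducible representation, a coordinate of highest weight does not vanish identically on
the orbit of a nonzero vector under the upper triangular unipotent group. -/
theorem exists_coord_upperSL2_ne_zero (hσ : IsRational σ) (hirr : σ.IsIrreducible)
    (hc : ∀ i p, σ (diagSL2 p) (c i) = (p : ℂ) ^ wt' i • c i) (i : κ) (hi : ∀ j, wt' j ≤ wt' i)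
    {w : W} (hw : w ≠ 0) : ∃ x, c.coord i (σ (upperSL2 x) w) ≠ 0 := by
  by_contra! h
  -- On the big cell `g` is lower times diagonal times upper, and the first two factors do not
  -- affect the vanishing of a top coordinate.
  have h1 : ∀ g : SL(2, ℂ), g 0 0 ≠ 0 → c.coord i (σ g w) = 0 := by
    intro g hg
    rw [eq_lowerSL2_mul_diagSL2_mul_upperSL2 g (Units.mk0 _ hg) rfl, map_mul, map_mul,
      Module.End.mul_apply, Module.End.mul_apply, coord_lowerSL2_of_maximal hσ hc i hi,
      coord_diagSL2 hc, h, mul_zero]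
  have h2 : ∀ g : SL(2, ℂ), c.coord i (σ g w) = 0 := by
    intro g
    by_cases hg : g 0 0 = 0
    swap
    · exact h1 g hg
    have hg1 : g 1 0 ≠ 0 := by
      intro hg1
      have := g.2
      rw [Matrix.det_fin_two, hg, hg1] at this
      simp at this
    -- The curve `u(x) g` lies in the big cell for `x ≠ 0`, so the polynomial coordinate vanishes at
    -- `x = 0` too.
    obtain ⟨P, hP⟩ := hσ.exists_polynomial (c.coord i) (σ g w) !![1, Polynomial.X; 0, 1]
    have hP' : ∀ x, c.coord i (σ (upperSL2 x) (σ g w)) = P.eval x := fun x => hP x _ (by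
      intro i j; fin_cases i <;> fin_cases j <;> simp [coe_upperSL2])
    have hP0 : P * Polynomial.X = 0 := by
      refine Polynomial.funext fun x => ?_
      rw [Polynomial.eval_mul, Polynomial.eval_X, Polynomial.eval_zero]
      by_cases hx : x = 0
      · rw [hx, mul_zero]
      · rw [← hP', ← Module.End.mul_apply, ← map_mul, h1, zero_mul]
        rw [Matrix.SpecialLinearGroup.coe_mul, coe_upperSL2, Matrix.mul_apply, Fin.sum_univ_two]
        simpa [hg] using ⟨hx, hg1⟩
    have h0 := hP' 0
    rw [upperSL2_zero, map_one, Module.End.one_apply] at h0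
    rw [h0, (mul_eq_zero.1 hP0).resolve_right Polynomial.X_ne_zero, Polynomial.eval_zero]
  -- The vectors whose whole orbit is killed by the coordinate: it contains `w` but not `c i`,
  -- against irreducibility.
  let U : Subrepresentation σ :=
    { toSubmodule := ⨅ g, LinearMap.ker (c.coord i ∘ₗ σ g)
      apply_mem_toSubmodule := by
        intro g z hz
        rw [Submodule.mem_iInf] at hz ⊢
        intro k
        have := hz (k * g)
        rw [LinearMap.mem_ker, LinearMap.comp_apply] at this ⊢
        rwa [map_mul] at this }
  rcases hirr.eq_bot_or_eq_top U with hU | hU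
  · have hwU : w ∈ U.toSubmodule := by
      change w ∈ ⨅ g, LinearMap.ker (c.coord i ∘ₗ σ g)
      rw [Submodule.mem_iInf]
      exact h2
    rw [hU] at hwU
    exact hw ((Submodule.mem_bot ℂ).1 hwU)
  · have hci : c i ∈ U.toSubmodule := by rw [hU]; trivial
    have := (Submodule.mem_iInf _).1 hci 1
    rw [LinearMap.mem_ker, LinearMap.comp_apply, map_one] at this
    simp at this

end


/-! ### Semistability for irreducible representations of `SL(2, ℂ)` -/

theorem exists_le_norm_eval {R : Polynomial ℂ} (hR : R.eval 0 ≠ 0) :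
    ∃ a > 0, ∀ᶠ x in 𝓝 (0 : ℂ), a ≤ ‖R.eval x‖ := by
  refine ⟨‖R.eval 0‖ / 2, by positivity, ?_⟩
  have h : Filter.Tendsto (fun x => ‖R.eval x‖) (𝓝 0) (𝓝 ‖R.eval 0‖) :=
    (R.continuous.norm).tendsto 0
  refine (h.eventually (lt_mem_nhds (a := ‖R.eval 0‖ / 2) ?_)).mono fun x hx => hx.le
  exact half_lt_self (by positivity)

/-- With `q = min k n`, the left side is at most a constant times `s^μ (s² y)^q`, and the `q`-th
power of a nonnegative number is at most `1` plus its `n`-th power. The power of two pays for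
raising the exponent of `s` when `s < 1`. -/
theorem zpow_mul_pow_le {s y : ℝ} (hs : 1 / 2 ≤ s) (hy0 : 0 ≤ y) (hy1 : y ≤ 1) {m μ : ℤ} {k n : ℕ}
    (hk : m ≤ μ + 2 * k) (hn : m ≤ μ + 2 * n) :
    s ^ m * y ^ k ≤ 2 ^ (μ + 2 * n - m).toNat * (s ^ μ + s ^ (μ + 2 * n) * y ^ n) := by
  have hs0 : 0 < s := by linarith
  obtain ⟨q, hqk, hqn, hq⟩ : ∃ q : ℕ, q ≤ k ∧ q ≤ n ∧ m ≤ μ + 2 * q := by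
    rcases le_total k n with h | h
    · exact ⟨k, le_rfl, h, hk⟩
    · exact ⟨n, h, le_rfl, hn⟩
  obtain ⟨e, he⟩ : ∃ e : ℕ, μ + 2 * q = m + e := ⟨(μ + 2 * q - m).toNat, by omega⟩
  have h1 : y ^ k ≤ y ^ q := pow_le_pow_of_le_one hy0 hy1 hqk
  have h2 : s ^ m ≤ 2 ^ e * s ^ (μ + 2 * q) := by
    rw [he, zpow_add₀ hs0.ne', zpow_natCast]
    have : 1 ≤ (2 * s) ^ e := one_le_pow₀ (by linarith)
    calc s ^ m = s ^ m * 1 := (mul_one _).symm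
      _ ≤ s ^ m * (2 * s) ^ e := by gcongr
      _ = 2 ^ e * (s ^ m * s ^ e) := by rw [mul_pow]; ring
  have hz : ∀ q : ℕ, s ^ (μ + 2 * q) * y ^ q = s ^ μ * (s ^ 2 * y) ^ q := by
    intro q
    rw [zpow_add₀ hs0.ne', zpow_mul, zpow_natCast, mul_pow]
    norm_cast
    ring
  have h3 : (s ^ 2 * y) ^ q ≤ 1 + (s ^ 2 * y) ^ n := by
    have h0 : 0 ≤ s ^ 2 * y := by positivity
    rcases le_total (s ^ 2 * y) 1 with h | h
    · exact (pow_le_one₀ h0 h).trans (le_add_of_nonneg_right (by positivity))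
    · exact (pow_le_pow_right₀ h hqn).trans (le_add_of_nonneg_left zero_le_one)
  have h4 : (2 : ℝ) ^ e ≤ 2 ^ (μ + 2 * n - m).toNat := pow_le_pow_right₀ one_le_two (by omega)
  calc s ^ m * y ^ k ≤ (2 ^ e * s ^ (μ + 2 * q)) * y ^ q := by gcongr
    _ = 2 ^ e * (s ^ μ * (s ^ 2 * y) ^ q) := by rw [mul_assoc, hz]
    _ ≤ 2 ^ (μ + 2 * n - m).toNat * (s ^ μ * (1 + (s ^ 2 * y) ^ n)) := by gcongr
    _ = _ := by rw [hz]; ring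

/-! ### Bounded group elements and pivoting. -/

theorem exists_bound_eval {σ : Type*} (p : MvPolynomial σ ℂ) :
    ∃ B : ℝ, ∀ x : σ → ℂ, (∀ i, ‖x i‖ ≤ 1) → ‖MvPolynomial.eval x p‖ ≤ B := by
  induction p using MvPolynomial.induction_on with
  | C a => exact ⟨‖a‖, fun x _ => by simp⟩
  | add p q hp hq =>
    obtain ⟨A, hA⟩ := hp
    obtain ⟨B, hB⟩ := hq
    exact ⟨A + B, fun x hx => by
      rw [map_add]; exact (norm_add_le _ _).trans (add_le_add (hA x hx) (hB x hx))⟩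
  | mul_X p i hp =>
    obtain ⟨A, hA⟩ := hp
    refine ⟨A, fun x hx => ?_⟩
    rw [map_mul, MvPolynomial.eval_X, norm_mul]
    exact (mul_le_of_le_one_right (norm_nonneg _) (hx i)).trans (hA x hx)

theorem IsRational.exists_bound {V ι : Type*} [AddCommGroup V] [Module ℂ V] [Fintype ι] {n : ℕ}
    {ρ : Representation ℂ SL(n, ℂ) V} (hρ : IsRational ρ) (b : Module.Basis ι ℂ V) :
    ∃ C, 0 ≤ C ∧ ∀ (g : SL(n, ℂ)) (z : V), (∀ i j, ‖g i j‖ ≤ 1) →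
      ∑ i, ‖b.coord i (ρ g z)‖ ≤ C * ∑ i, ‖b.coord i z‖ := by
  have h : ∀ i j, ∃ B : ℝ, ∀ g : SL(n, ℂ), (∀ i j, ‖g i j‖ ≤ 1) → ‖b.coord i (ρ g (b j))‖ ≤ B := by
    intro i j
    obtain ⟨p, hp⟩ := hρ.2 (b.coord i) (b j)
    obtain ⟨B, hB⟩ := exists_bound_eval p
    exact ⟨B, fun g hg => by rw [hp]; exact hB _ fun ij => hg ij.1 ij.2⟩
  choose B hB using h
  refine ⟨∑ i, ∑ j, |B i j|, by positivity, fun g z hg => ?_⟩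
  rw [Finset.sum_mul]
  refine Finset.sum_le_sum fun i _ => ?_
  have hz : b.coord i (ρ g z) = ∑ j, b.coord j z * b.coord i (ρ g (b j)) := by
    conv_lhs => rw [← b.sum_repr z]
    rw [map_sum, map_sum]
    exact Finset.sum_congr rfl fun j _ => by rw [map_smul, map_smul, smul_eq_mul]; rfl
  rw [hz, Finset.sum_mul]
  refine (norm_sum_le _ _).trans (Finset.sum_le_sum fun j _ => ?_)
  rw [norm_mul, mul_comm]
  refine mul_le_mul ((hB i j g hg).trans (le_abs_self _)) ?_ (norm_nonneg _) (abs_nonneg _)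
  exact Finset.single_le_sum (f := fun j => ‖b.coord j z‖) (fun _ _ => norm_nonneg _)
    (Finset.mem_univ j)

/-- Gaussian elimination with complete pivoting. -/
theorem exists_pivot_decomposition (g : SL(2, ℂ)) :
    ∃ (k : SL(2, ℂ)) (p : ℂˣ) (x : ℂ) (h : SL(2, ℂ)), (∀ i j, ‖k i j‖ ≤ 1) ∧ 1 / 2 ≤ ‖(p : ℂ)‖ ∧
      ‖x‖ ≤ 1 ∧ (h = 1 ∨ h = ⟨!![0, 1; -1, 0], by simp [Matrix.det_fin_two]⟩) ∧
      g = k * diagSL2 p * upperSL2 x * h := by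
  let s : SL(2, ℂ) := ⟨!![0, 1; -1, 0], by simp [Matrix.det_fin_two]⟩
  have hs : (s : Matrix (Fin 2) (Fin 2) ℂ) = !![0, 1; -1, 0] := rfl
  have hs' : ((s⁻¹ : SL(2, ℂ)) : Matrix (Fin 2) (Fin 2) ℂ) = !![0, -1; 1, 0] := by
    rw [Matrix.SpecialLinearGroup.coe_inv, hs, Matrix.adjugate_fin_two]
    simp
  have h00 : ∀ g : SL(2, ℂ), (∀ i j, ‖g i j‖ ≤ ‖g 0 0‖) →
      ∃ (y : ℂ) (p : ℂˣ) (x : ℂ), ‖y‖ ≤ 1 ∧ 1 / 2 ≤ ‖(p : ℂ)‖ ∧ ‖x‖ ≤ 1 ∧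
        g = lowerSL2 y * diagSL2 p * upperSL2 x := by
    intro g hg
    have hdet := g.2
    rw [Matrix.det_fin_two] at hdet
    -- The pivot is the largest entry and the determinant is one, which bounds the pivot below.
    have h1 : 1 ≤ 2 * ‖g 0 0‖ ^ 2 := by
      calc (1 : ℝ) = ‖g 0 0 * g 1 1 - g 0 1 * g 1 0‖ := by rw [hdet]; simp
        _ ≤ ‖g 0 0‖ * ‖g 1 1‖ + ‖g 0 1‖ * ‖g 1 0‖ := by
          refine (norm_sub_le _ _).trans ?_
          rw [norm_mul, norm_mul]
        _ ≤ ‖g 0 0‖ * ‖g 0 0‖ + ‖g 0 0‖ * ‖g 0 0‖ := by gcongr <;> exact hg _ _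
        _ = _ := by ring
    have h2 : 1 / 2 ≤ ‖g 0 0‖ := by nlinarith [norm_nonneg (g 0 0)]
    have h3 : g 0 0 ≠ 0 := by
      intro h
      rw [h] at h2
      norm_num at h2
    have h4 : ∀ z : ℂ, ‖z‖ ≤ ‖g 0 0‖ → ‖z / (Units.mk0 _ h3 : ℂˣ)‖ ≤ 1 := by
      intro z hz
      rw [norm_div, Units.val_mk0]
      exact div_le_one_of_le₀ hz (norm_nonneg _)
    exact ⟨_, Units.mk0 _ h3, _, h4 _ (hg 1 0), h2, h4 _ (hg 0 1),
      eq_lowerSL2_mul_diagSL2_mul_upperSL2 g _ rfl⟩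
  have h0 : ∀ g : SL(2, ℂ), ((∀ i j, ‖g i j‖ ≤ ‖g 0 0‖) ∨ ∀ i j, ‖g i j‖ ≤ ‖g 1 0‖) →
      ∃ (k : SL(2, ℂ)) (p : ℂˣ) (x : ℂ), (∀ i j, ‖k i j‖ ≤ 1) ∧ 1 / 2 ≤ ‖(p : ℂ)‖ ∧ ‖x‖ ≤ 1 ∧
        g = k * diagSL2 p * upperSL2 x := by
    rintro g (hg | hg)
    · obtain ⟨y, p, x, hy, hp, hx, h⟩ := h00 g hg
      refine ⟨lowerSL2 y, p, x, fun i j => ?_, hp, hx, h⟩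
      rw [coe_lowerSL2]
      fin_cases i <;> fin_cases j <;> simp [hy]
    · obtain ⟨y, p, x, hy, hp, hx, h⟩ := h00 (s * g) (by
        intro i j
        rw [Matrix.SpecialLinearGroup.coe_mul, hs]
        fin_cases i <;> simpa [Matrix.mul_apply, Fin.sum_univ_two] using hg _ _)
      refine ⟨s⁻¹ * lowerSL2 y, p, x, fun i j => ?_, hp, hx, ?_⟩
      · rw [Matrix.SpecialLinearGroup.coe_mul, hs', coe_lowerSL2]
        fin_cases i <;> fin_cases j <;> simp [Matrix.mul_apply, Fin.sum_univ_two, hy]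
      · rw [mul_assoc, mul_assoc, ← mul_assoc (lowerSL2 y), ← h]
        group
  -- A row swap is absorbed into the bounded factor `k`; a column swap becomes `h`.
  obtain ⟨⟨i₀, j₀⟩, hmax⟩ := Finite.exists_max fun ij : Fin 2 × Fin 2 => ‖g ij.1 ij.2‖
  fin_cases j₀
  · obtain ⟨k, p, x, hk, hp, hx, h⟩ := h0 g (by
      fin_cases i₀
      · exact Or.inl fun i j => hmax (i, j)
      · exact Or.inr fun i j => hmax (i, j))
    exact ⟨k, p, x, 1, hk, hp, hx, Or.inl rfl, by rw [mul_one]; exact h⟩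
  · have hcol : ∀ i, ‖(g * s⁻¹ : SL(2, ℂ)) i 0‖ = ‖g i 1‖ := by
      intro i
      rw [Matrix.SpecialLinearGroup.coe_mul, hs']
      simp [Matrix.mul_apply, Fin.sum_univ_two]
    have hcol1 : ∀ i, ‖(g * s⁻¹ : SL(2, ℂ)) i 1‖ = ‖g i 0‖ := by
      intro i
      rw [Matrix.SpecialLinearGroup.coe_mul, hs']
      simp [Matrix.mul_apply, Fin.sum_univ_two]
    have hle : ∀ i j, ‖(g * s⁻¹ : SL(2, ℂ)) i j‖ ≤ ‖g i₀ 1‖ := by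
      intro i j
      fin_cases j
      · exact (hcol i).trans_le (hmax (i, 1))
      · exact (hcol1 i).trans_le (hmax (i, 0))
    obtain ⟨k, p, x, hk, hp, hx, h⟩ := h0 (g * s⁻¹) (by
      fin_cases i₀
      · exact Or.inl fun i j => (hle i j).trans_eq (hcol 0).symm
      · exact Or.inr fun i j => (hle i j).trans_eq (hcol 1).symm)
    exact ⟨k, p, x, s, hk, hp, hx, Or.inr rfl, by rw [← h]; group⟩

section

variable {V W ι κ : Type*} [AddCommGroup V] [Module ℂ V] [AddCommGroup W] [Module ℂ W]
  [Fintype ι] [Fintype κ]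
  {ρ : Representation ℂ SL(2, ℂ) V} {σ : Representation ℂ SL(2, ℂ) W}
  {b : Module.Basis ι ℂ V} {wt : ι → ℤ} {c : Module.Basis κ ℂ W} {wt' : κ → ℤ}

/-- The coordinates of highest weight of `u(x) w` vanish at `x = 0` to the order that is prescribed
by the highest weight of `w`. -/
theorem exists_order_upperSL2 (hσ : IsRational σ) (hirr : σ.IsIrreducible)
    (hc : ∀ i p, σ (diagSL2 p) (c i) = (p : ℂ) ^ wt' i • c i) (i₀ : κ) (hi₀ : ∀ j, wt' j ≤ wt' i₀)
    {w : W} {i₁ : κ} (hi₁ : c.coord i₁ w ≠ 0) (hmax : ∀ j, c.coord j w ≠ 0 → wt' j ≤ wt' i₁) :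
    ∃ (n : ℕ) (R : Polynomial ℂ), wt' i₀ = wt' i₁ + 2 * n ∧ R.eval 0 ≠ 0 ∧
      ∀ x, c.coord i₀ (σ (upperSL2 x) w) = x ^ n * R.eval x := by
  classical
  -- The component of highest occurring weight. Irreducibility gives it a nonzero top coordinate
  -- polynomial `Q₁`, necessarily a multiple of `x^n`.
  let w₁ : W := ∑ j, if wt' j = wt' i₁ then c.coord j w • c j else 0
  have hw₁ : ∀ j, c.coord j w₁ = if wt' j = wt' i₁ then c.coord j w else 0 := by
    intro j
    simp only [w₁, map_sum]
    rw [Finset.sum_eq_single j]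
    · split_ifs <;> simp
    · intro k _ hk
      split_ifs
      · simp [Finsupp.single_eq_of_ne hk.symm]
      · simp
    · simp
  have hw₁0 : w₁ ≠ 0 := by
    intro h
    have := hw₁ i₁
    rw [h, map_zero, if_pos rfl] at this
    exact hi₁ this.symm
  obtain ⟨x₁, hx₁⟩ := exists_coord_upperSL2_ne_zero hσ hirr hc i₀ hi₀ hw₁0
  obtain ⟨Q, hQ, hQk⟩ := exists_polynomial_upperSL2 hσ hc i₀ w
  obtain ⟨Q₁, hQ₁, hQ₁k⟩ := exists_polynomial_upperSL2 hσ hc i₀ w₁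
  obtain ⟨Q₂, hQ₂, hQ₂k⟩ := exists_polynomial_upperSL2 hσ hc i₀ (w - w₁)
  have hsum : Q = Q₁ + Q₂ := by
    refine Polynomial.funext fun x => ?_
    rw [Polynomial.eval_add, ← hQ, ← hQ₁, ← hQ₂, ← map_add, ← map_add, add_sub_cancel]
  obtain ⟨n, hn⟩ : ∃ n, Q₁.coeff n ≠ 0 := by
    by_contra! h
    have : Q₁ = 0 := Polynomial.ext h
    rw [hQ₁, this, Polynomial.eval_zero] at hx₁
    exact hx₁ rfl
  have hd : wt' i₀ = wt' i₁ + 2 * n := by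
    obtain ⟨j, hj, hjn⟩ := hQ₁k n hn
    rw [hw₁] at hj
    by_cases h : wt' j = wt' i₁
    · rw [← h, hjn]
    · rw [if_neg h] at hj
      exact (hj rfl).elim
  -- The other components have different weights, so they cannot cancel the coefficient of `x^n`.
  have hQ₂n : Q₂.coeff n = 0 := by
    by_contra h
    obtain ⟨j, hj, hjn⟩ := hQ₂k n h
    rw [map_sub, hw₁, if_pos (by omega), sub_self] at hj
    exact hj rfl
  -- A term of degree below `n` would come from a weight of `w` above `wt' i₁`.
  obtain ⟨R, hR⟩ : Polynomial.X ^ n ∣ Q := by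
    rw [Polynomial.X_pow_dvd_iff]
    intro k hk
    by_contra h
    obtain ⟨j, hj, hjk⟩ := hQk k h
    have := hmax j hj
    omega
  refine ⟨n, R, hd, ?_, fun x => by rw [hQ, hR]; simp⟩
  have : Q.coeff n = R.coeff 0 := by
    have := Polynomial.coeff_X_pow_mul R n 0
    rw [zero_add, ← hR] at this
    exact this
  rw [← Polynomial.coeff_zero_eq_eval_zero, ← this, hsum, Polynomial.coeff_add, hQ₂n, add_zero]
  exact hn

/-- Near `x = 0`, the coordinates `i₁` and `i₀` of `w` bound `|p|^μ` and `|p|^(μ+2n) |x|^n` by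
multiples of the norm on the right, and these two quantities control every monomial in the
coordinates of `v`. -/
theorem WeightDominated.eventually_le (hρ : IsRational ρ) (hσ : IsRational σ)
    (hirr : σ.IsIrreducible)
    (hb : ∀ i p, ρ (diagSL2 p) (b i) = (p : ℂ) ^ wt i • b i)
    (hc : ∀ i p, σ (diagSL2 p) (c i) = (p : ℂ) ^ wt' i • c i) {v : V} {w : W} (hw : w ≠ 0)
    (h : WeightDominated ρ σ b wt c wt' v w) :
    ∃ C, ∀ᶠ x in 𝓝 (0 : ℂ), ∀ p : ℂˣ, 1 / 2 ≤ ‖(p : ℂ)‖ →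
      ∑ i, ‖b.coord i (ρ (diagSL2 p) (ρ (upperSL2 x) v))‖ ≤
        C * ∑ j, ‖c.coord j (σ (diagSL2 p) (σ (upperSL2 x) w))‖ := by
  classical
  obtain ⟨j₀, hj₀⟩ : ∃ j, c.coord j w ≠ 0 := by
    by_contra! h0
    exact hw (c.ext_elem fun j => by simpa using h0 j)
  obtain ⟨i₁, hi₁, hmax⟩ := (Finset.univ.filter fun j => c.coord j w ≠ 0).exists_max_image wt'
    ⟨j₀, by simpa using hj₀⟩
  replace hi₁ : c.coord i₁ w ≠ 0 := (Finset.mem_filter.1 hi₁).2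
  replace hmax : ∀ j, c.coord j w ≠ 0 → wt' j ≤ wt' i₁ := fun j hj =>
    hmax j (Finset.mem_filter.2 ⟨Finset.mem_univ _, hj⟩)
  obtain ⟨i₀, -, hi₀⟩ := Finset.univ.exists_max_image wt' ⟨j₀, Finset.mem_univ _⟩
  replace hi₀ : ∀ j, wt' j ≤ wt' i₀ := fun j => hi₀ j (Finset.mem_univ _)
  obtain ⟨n, R, hd, hR0, hR⟩ := exists_order_upperSL2 hσ hirr hc i₀ hi₀ hi₁ hmax
  obtain ⟨S, hS, -⟩ := exists_polynomial_upperSL2 hσ hc i₁ w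
  have hS0 : S.eval 0 ≠ 0 := by
    rw [← hS, upperSL2_zero, map_one, Module.End.one_apply]
    exact hi₁
  obtain ⟨a, ha, haR⟩ := exists_le_norm_eval hR0
  obtain ⟨a', ha', haS⟩ := exists_le_norm_eval hS0
  set μ := wt' i₁ with hμ
  -- the upper bound for the coordinates of `v`
  have hup : ∀ i, ∃ C, 0 ≤ C ∧ ∀ (x : ℂ) (p : ℂˣ), ‖x‖ ≤ 1 → 1 / 2 ≤ ‖(p : ℂ)‖ →
      ‖b.coord i (ρ (diagSL2 p) (ρ (upperSL2 x) v))‖ ≤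
        C * (‖(p : ℂ)‖ ^ μ + ‖(p : ℂ)‖ ^ (μ + 2 * n) * ‖x‖ ^ n) := by
    intro i
    obtain ⟨P, hP, hPk⟩ := exists_polynomial_upperSL2 hρ hb i v
    refine ⟨∑ k ∈ Finset.range (P.natDegree + 1), ‖P.coeff k‖ * 2 ^ (μ + 2 * n - wt i).toNat,
      by positivity, fun x p hx hp => ?_⟩
    rw [coord_diagSL2 hb, hP, Polynomial.eval_eq_sum_range, norm_mul, norm_zpow, Finset.sum_mul]
    refine (mul_le_mul_of_nonneg_left (norm_sum_le _ _) (by positivity)).trans ?_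
    rw [Finset.mul_sum]
    refine Finset.sum_le_sum fun k _ => ?_
    rw [norm_mul, norm_pow]
    by_cases hk : P.coeff k = 0
    · simp [hk]
    -- The coefficient of `x^k` comes from a weight `wt i - 2 * k` of `v` itself, which domination
    -- at the identity bounds by `μ`.
    have h1 : wt i ≤ μ + 2 * k := by
      obtain ⟨j, hj, hjk⟩ := hPk k hk
      obtain ⟨j', hj', hle⟩ := h 1 j (by rwa [map_one, Module.End.one_apply])
      rw [map_one, Module.End.one_apply] at hj'
      have := hmax j' hj'
      omega
    -- Some translate of `v` has the weight `wt i`, so domination there bounds it by the highest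
    -- weight of `W`.
    have h2 : wt i ≤ μ + 2 * n := by
      obtain ⟨x, hx⟩ : ∃ x, P.eval x ≠ 0 := by
        by_contra! h0
        exact hk (by rw [Polynomial.funext (p := P) (q := 0) (by simpa using h0)]; simp)
      obtain ⟨j', -, hle⟩ := h (upperSL2 x) i (by rwa [hP])
      have := hi₀ j'
      omega
    have := zpow_mul_pow_le hp (norm_nonneg x) hx h1 h2
    calc ‖(p : ℂ)‖ ^ wt i * (‖P.coeff k‖ * ‖x‖ ^ k) =
        ‖P.coeff k‖ * (‖(p : ℂ)‖ ^ wt i * ‖x‖ ^ k) := by ring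
      _ ≤ ‖P.coeff k‖ * _ := mul_le_mul_of_nonneg_left this (norm_nonneg _)
      _ = _ := by ring
  choose C hC0 hC using hup
  refine ⟨(∑ i, C i) * (1 / a' + 1 / a), ?_⟩
  filter_upwards [haR, haS, Metric.closedBall_mem_nhds (0 : ℂ) one_pos] with x hxR hxS hx p hp
  rw [mem_closedBall_zero_iff] at hx
  set N := ∑ j, ‖c.coord j (σ (diagSL2 p) (σ (upperSL2 x) w))‖ with hN
  have hle : ∀ j, ‖c.coord j (σ (diagSL2 p) (σ (upperSL2 x) w))‖ ≤ N := fun j =>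
    Finset.single_le_sum (f := fun j => ‖c.coord j (σ (diagSL2 p) (σ (upperSL2 x) w))‖)
      (fun _ _ => norm_nonneg _) (Finset.mem_univ j)
  have hp0 : 0 < ‖(p : ℂ)‖ := by linarith
  have h1 : ‖(p : ℂ)‖ ^ μ ≤ 1 / a' * N := by
    have := hle i₁
    rw [coord_diagSL2 hc, hS, norm_mul, norm_zpow] at this
    rw [one_div, ← div_eq_inv_mul, le_div_iff₀ ha']
    exact (mul_le_mul_of_nonneg_left hxS (by positivity)).trans this
  have h2 : ‖(p : ℂ)‖ ^ (μ + 2 * n) * ‖x‖ ^ n ≤ 1 / a * N := by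
    have := hle i₀
    rw [coord_diagSL2 hc, hR, norm_mul, norm_zpow, norm_mul, norm_pow, ← mul_assoc, hd] at this
    rw [one_div, ← div_eq_inv_mul, le_div_iff₀ ha]
    exact (mul_le_mul_of_nonneg_left hxR (by positivity)).trans this
  calc ∑ i, ‖b.coord i (ρ (diagSL2 p) (ρ (upperSL2 x) v))‖
      ≤ ∑ i, C i * (‖(p : ℂ)‖ ^ μ + ‖(p : ℂ)‖ ^ (μ + 2 * n) * ‖x‖ ^ n) :=
        Finset.sum_le_sum fun i _ => hC i x p hx hp
    _ = (∑ i, C i) * (‖(p : ℂ)‖ ^ μ + ‖(p : ℂ)‖ ^ (μ + 2 * n) * ‖x‖ ^ n) := by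
        rw [Finset.sum_mul]
    _ ≤ (∑ i, C i) * (1 / a' * N + 1 / a * N) :=
        mul_le_mul_of_nonneg_left (add_le_add h1 h2) (Finset.sum_nonneg fun i _ => hC0 i)
    _ = _ := by ring

theorem WeightDominated.exists_le_of_norm_le_one (hρ : IsRational ρ) (hσ : IsRational σ)
    (hirr : σ.IsIrreducible)
    (hb : ∀ i p, ρ (diagSL2 p) (b i) = (p : ℂ) ^ wt i • b i)
    (hc : ∀ i p, σ (diagSL2 p) (c i) = (p : ℂ) ^ wt' i • c i) {v : V} {w : W} (hw : w ≠ 0)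
    (h : WeightDominated ρ σ b wt c wt' v w) :
    ∃ C, ∀ x : ℂ, ‖x‖ ≤ 1 → ∀ p : ℂˣ, 1 / 2 ≤ ‖(p : ℂ)‖ →
      ∑ i, ‖b.coord i (ρ (diagSL2 p) (ρ (upperSL2 x) v))‖ ≤
        C * ∑ j, ‖c.coord j (σ (diagSL2 p) (σ (upperSL2 x) w))‖ := by
  let B : ℝ → ℂ → Prop := fun C x => ∀ p : ℂˣ, 1 / 2 ≤ ‖(p : ℂ)‖ →
      ∑ i, ‖b.coord i (ρ (diagSL2 p) (ρ (upperSL2 x) v))‖ ≤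
        C * ∑ j, ‖c.coord j (σ (diagSL2 p) (σ (upperSL2 x) w))‖
  have hB : ∀ {C C' x}, C ≤ C' → B C x → B C' x := fun hCC hBC p hp =>
    (hBC p hp).trans (mul_le_mul_of_nonneg_right hCC (Finset.sum_nonneg fun _ _ => norm_nonneg _))
  suffices ∃ C, ∀ x ∈ Metric.closedBall (0 : ℂ) 1, B C x by
    obtain ⟨C, hC⟩ := this
    exact ⟨C, fun x hx => hC x (mem_closedBall_zero_iff.2 hx)⟩
  refine (isCompact_closedBall (0 : ℂ) 1).induction_on (p := fun S => ∃ C, ∀ x ∈ S, B C x)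
    ⟨0, fun x hx => hx.elim⟩ ?_ ?_ ?_
  · rintro S T hST ⟨C, hC⟩
    exact ⟨C, fun x hx => hC x (hST hx)⟩
  · rintro S T ⟨C, hC⟩ ⟨C', hC'⟩
    refine ⟨max C C', ?_⟩
    rintro x (hx | hx)
    · exact hB (le_max_left _ _) (hC x hx)
    · exact hB (le_max_right _ _) (hC' x hx)
  · intro x₀ _
    have hw' : σ (upperSL2 x₀) w ≠ 0 := by
      intro h0
      have := congrArg (σ (upperSL2 x₀)⁻¹) h0
      rw [map_zero, ← Module.End.mul_apply, ← map_mul, inv_mul_cancel, map_one] at this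
      exact hw this
    -- Domination is invariant under translation, so the estimate at `0` moves to `x₀` through `u(x)
    -- = u(x - x₀) u(x₀)`; compactness then makes the constant uniform.
    obtain ⟨C, hC⟩ := (h.translate (upperSL2 x₀)).eventually_le hρ hσ hirr hb hc hw'
    have ht : Filter.Tendsto (fun x => x - x₀) (𝓝 x₀) (𝓝 0) := by
      have : Filter.Tendsto (fun x => x - x₀) (𝓝 x₀) (𝓝 (x₀ - x₀)) :=
        (continuous_id.sub continuous_const).tendsto x₀
      rwa [sub_self] at this
    refine ⟨{x | B C x}, mem_nhdsWithin_of_mem_nhds ?_, C, fun x hx => hx⟩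
    filter_upwards [ht.eventually hC] with x hx p hp
    have := hx p hp
    simp only [← Module.End.mul_apply (ρ (upperSL2 _)), ← Module.End.mul_apply (σ (upperSL2 _)),
      ← map_mul, ← upperSL2_add, sub_add_cancel] at this
    exact this

theorem WeightDominated.semistable (hρ : IsRational ρ) (hσ : IsRational σ)
    (hirr : σ.IsIrreducible)
    (hb : ∀ i p, ρ (diagSL2 p) (b i) = (p : ℂ) ^ wt i • b i)
    (hc : ∀ i p, σ (diagSL2 p) (c i) = (p : ℂ) ^ wt' i • c i) {v : V} {w : W} (hw : w ≠ 0)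
    (h : WeightDominated ρ σ b wt c wt' v w) : Semistable ρ σ v w := by
  have hw' : ∀ k, σ k w ≠ 0 := by
    intro k h0
    have := congrArg (σ k⁻¹) h0
    rw [map_zero, ← Module.End.mul_apply, ← map_mul, inv_mul_cancel, map_one] at this
    exact hw this
  have hex := fun k => (h.translate k).exists_le_of_norm_le_one hρ hσ hirr hb hc (hw' k)
  choose C hC using hex
  obtain ⟨A, hA0, hA⟩ := hρ.exists_bound b
  obtain ⟨B, hB0, hB⟩ := hσ.exists_bound c
  let s : SL(2, ℂ) := ⟨!![0, 1; -1, 0], by simp [Matrix.det_fin_two]⟩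
  let D := max 0 (max (C 1) (C s))
  refine semistable_of_le b c (A * (D * B)) fun g => ?_
  obtain ⟨k, p, x, t, hk, hp, hx, ht, rfl⟩ := exists_pivot_decomposition g
  have hCt : C t ≤ D := by
    rcases ht with rfl | rfl
    · exact (le_max_left _ _).trans (le_max_right _ _)
    · exact (le_max_right _ _).trans (le_max_right _ _)
  -- For two by two matrices of determinant one, inversion only permutes entries and changes signs,
  -- so `k` distorts norms boundedly in both directions.
  have hk' : ∀ i j, ‖(k⁻¹ : SL(2, ℂ)) i j‖ ≤ 1 := by
    intro i j
    rw [Matrix.SpecialLinearGroup.coe_inv, Matrix.adjugate_fin_two]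
    fin_cases i <;> fin_cases j <;> simp [hk]
  have h1 := hA k (ρ (diagSL2 p) (ρ (upperSL2 x) (ρ t v))) hk
  have h2 := hB k⁻¹ (σ k (σ (diagSL2 p) (σ (upperSL2 x) (σ t w)))) hk'
  rw [← Module.End.mul_apply (σ k⁻¹), ← map_mul, inv_mul_cancel, map_one,
    Module.End.one_apply] at h2
  have h3 := hC t x hx p hp
  simp only [map_mul, Module.End.mul_apply]
  set nv := ∑ i, ‖b.coord i (ρ (diagSL2 p) (ρ (upperSL2 x) (ρ t v)))‖
  set nw := ∑ i, ‖c.coord i (σ (diagSL2 p) (σ (upperSL2 x) (σ t w)))‖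
  have hnw : 0 ≤ nw := Finset.sum_nonneg fun _ _ => norm_nonneg _
  have hD : 0 ≤ D := le_max_left _ _
  calc _ ≤ A * nv := h1
    _ ≤ A * (C t * nw) := mul_le_mul_of_nonneg_left h3 hA0
    _ ≤ A * (D * nw) := by gcongr
    _ ≤ A * (D * (B * _)) := by gcongr
    _ = _ := by ring

end

theorem NumericallySemistable.semistable {V W : Type*} [AddCommGroup V] [Module ℂ V]
    [AddCommGroup W] [Module ℂ W] {ρ : Representation ℂ SL(2, ℂ) V}
    {σ : Representation ℂ SL(2, ℂ) W} (hρ : IsRational ρ) (hσ : IsRational σ)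
    (hirr : σ.IsIrreducible) {v : V} {w : W} (hw : w ≠ 0) (h : NumericallySemistable ρ σ v w) :
    Semistable ρ σ v w := by
  obtain ⟨b, wt, hb⟩ := hρ.exists_weight_basis_SL2
  obtain ⟨c, wt', hc⟩ := hσ.exists_weight_basis_SL2
  exact (h.weightDominated hρ hσ hb hc).semistable hρ hσ hirr hb hc hw

end

end PairStability

open PairStability in
theorem theorem1p1 :
    -- (1) for `SL(2, ℂ)` and `W` irreducible, the generalized numerical criterion holds
    (∀ (V W : Type*) [AddCommGroup V] [Module ℂ V] [AddCommGroup W] [Module ℂ W]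
      (ρ : Representation ℂ SL(2, ℂ) V) (σ : Representation ℂ SL(2, ℂ) W),
      IsRational ρ → IsRational σ → σ.IsIrreducible →
      ∀ (v : V) (w : W), v ≠ 0 → w ≠ 0 →
        NumericallySemistable ρ σ v w → Semistable ρ σ v w) ∧
    -- (2) for `SL(2, ℂ)`, it fails for the reducible `W = Sym^n ⊕ Sym^(n-2)` and `V = Sym^n`,
    -- with `v = e₁ e₂^(n-1)` and `w = e₁^n + e₂^(n-2)`
    (∀ (n : ℕ) (hn : 3 ≤ n),
      let ρ : Representation ℂ SL(2, ℂ) (Sym 2 n) := symRep 2 n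
      let σ : Representation ℂ SL(2, ℂ) (Sym 2 n × Sym 2 (n - 2)) :=
        (symRep 2 n).prod (symRep 2 (n - 2))
      let v : Sym 2 n := monomial₂ 1 (n - 1) (by omega)
      let w : Sym 2 n × Sym 2 (n - 2) :=
        (monomial₂ n 0 (by omega), monomial₂ 0 (n - 2) (by omega))
      IsRational ρ ∧ IsRational σ ∧ ¬ σ.IsIrreducible ∧ v ≠ 0 ∧ w ≠ 0 ∧
        NumericallySemistable ρ σ v w ∧ ¬ Semistable ρ σ v w) ∧
    -- (3) for `SL(3, ℂ)`, it fails for some irreducible and homogeneous `V` and `W`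
    (∃ (V W : Type) (_ : AddCommGroup V) (_ : Module ℂ V) (_ : AddCommGroup W) (_ : Module ℂ W)
      (ρ : Representation ℂ SL(3, ℂ) V) (σ : Representation ℂ SL(3, ℂ) W) (v : V) (w : W),
      IsRational ρ ∧ IsRational σ ∧ ρ.IsIrreducible ∧ σ.IsIrreducible ∧ Homogeneous ρ σ ∧
        v ≠ 0 ∧ w ≠ 0 ∧ NumericallySemistable ρ σ v w ∧ ¬ Semistable ρ σ v w) := by
  refine ⟨fun V W _ _ _ _ ρ σ hρ hσ hirr v w _ hw h => h.semistable hρ hσ hirr hw, ?_, ?_⟩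
  · intro n hn
    exact ⟨isRational_symRep 2 n, (isRational_symRep 2 n).prod (isRational_symRep 2 (n - 2)),
      not_isIrreducible_prod _ _ (monomial₂_ne_zero n 0 (by omega))
        (monomial₂_ne_zero 0 (n - 2) (by omega)),
      monomial₂_ne_zero _ _ _, fun h => monomial₂_ne_zero n 0 (by omega) (congrArg Prod.fst h),
      numericallySemistable_monomial₂ n hn _ _ _, not_semistable_monomial₂ n hn _ _ _⟩
  · exact ⟨Sym 3 2, Sym 3 4, inferInstance, inferInstance, inferInstance, inferInstance,
      dualSymRep 3 2, symRep 3 4, dualPair, conicPair, isRational_dualSymRep 3 2,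
      isRational_symRep 3 4, isIrreducible_dualSymRep (by norm_num) 2,
      isIrreducible_symRep (by norm_num) 4, homogeneous_dualSymRep_symRep, dualPair_ne_zero,
      conicPair_ne_zero, numericallySemistable_conicPair, not_semistable_conicPair⟩
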